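/- **Setting (the Kudzu protocol).** There are $n\ge 3f+2p+1$ replicas ($f\ge1$, $p\ge0$), of which a fixed set of $f'\le f$ is corrupt (arbitrary behaviour); the others are honest. Channels are authenticated, signatures are unforgeable, the hash function has no collisions, and a signature certificate on an object with threshold $k$ can exist only once $k-f'$ honest replicas have issued signature shares on it. Payloads are encoded by an $(n,f+p+1)$-erasure code; a tag $\tau=(\beta,r)$ consists of the length $\beta$ of the payload and the Merkle root $r$ of its fragments, and a certified fragment for $\tau$ at position $i$ is a fragment of the right length with a valid Merkle path to $r$ from position $i$. $\mathrm{Decode}$ reconstructs a payload from $f+p+1$ certified fragments for $\tau$, and fails unless re-encoding the result gives the root $r$. A block for slot $v\ge 1$ is $B=\mathrm{Block}(v,\tau,h)$, where $h$ is the hash of the parent block ($\bot$ for the genesis block, which has slot $0$); $B_v^{\mathrm{timeout}}=\mathrm{Block}(v,\bot,\bot)$ is the timeout block. A notarization vote for $B$ consists of a signature share on $\mathrm{Notar}(B)$ and the sender's certified fragment for $B$ (no fragment for a timeout block); a first vote for $B$ is a share on $\mathrm{First}(B)$ together with a notarization vote for $B$; a finalization vote for $B$ is a share on $\mathrm{Final}(B)$.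 Certificates on $\mathrm{Notar}(B)$, $\mathrm{First}(B)$, $\mathrm{Final}(B)$ have thresholds $n-f-p$, $n-p$, $n-f-p$; those on $\mathrm{Notar}(B_v^{\mathrm{timeout}})$ are timeout certificates for $v$, and certificates on $\mathrm{First}(B)$ and $\mathrm{Final}(B)$ are used for non-timeout blocks only. "Broadcast" means sending to all replicas. Every honest replica keeps a pool of votes and certificates; it adds to the pool, and broadcasts, every new certificate that it receives or has enough votes to generate. It also keeps a complete block tree rooted at the genesis block. It adds a non-timeout block $B$ to the tree when it has a notarization certificate for $B$, the parent of $B$ is in the tree, and fragments in $f+p+1$ received notarization votes for $B$ decode to a payload that satisfies a correctness predicate, which may depend on the path of blocks and payloads from genesis to $B$. It goes through slots $v=1,2,\dots$; upon entering a slot it records its local clock as $T_{\mathrm{start}}$ and resets its slot variables, and then it performs any of the following as soon as possible, until it exits the slot. - If a block $B$ for slot $v$ is in its tree: exit the slot, remember $B$ as the parent of its next proposal, and broadcast a finalization vote for $B$ if it has sent no notarization vote in the slot for another block. - If a timeout certificate for $v$ is in its pool: exit the slot. - If it is the leader of slot $v$ and has not proposed yet: send to each replica its certified fragment of a new block for slot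 $v$ with a valid payload, whose parent is the remembered block (initially the genesis block). - If it has not first-voted in the slot, and the leader has sent it a block for slot $v$ with a certified fragment at its own position, such that its tree contains the parent, in some slot $v'<v$, and its pool has timeout certificates for $v'+1,\dots,v-1$: broadcast a first vote for that block. - If it has not first-voted in the slot and its clock passes $T_{\mathrm{start}}+\Delta_{\mathrm{timeout}}$: broadcast a first vote for $B_v^{\mathrm{timeout}}$. - If a first vote for a block of slot $v$ is received from a replica for which none is recorded: record it. - If it has first-voted, at least $f+p+1$ recorded first votes are for the same non-timeout block $B$ at which it has not yet taken a second look, and the parent of $B$ is in its tree: take a second look at $B$, i.e. reconstruct the payload of $B$ from received fragments, and broadcast a notarization vote for $B$ if this succeeds with a valid payload, and one for $B_v^{\mathrm{timeout}}$ otherwise (unless it has already sent that vote). - If it has first-voted, the number of recorded first votes minus the maximal number of them on a single non-timeout block is at least $f+p+1$, and it has not yet sent a notarization vote for $B_v^{\mathrm{timeout}}$: broadcast one. Honest replicas react instantaneously, and their local clocks have arbitrary offsets but all run at the rate of real time; $\Delta_{\mathrm{timeout}}\ge 0$. The network is *$\delta$-synchronous at time $t$* if every message sent by an honest replica to an honest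 replica at or before time $t$ is received before time $t+\delta$. It is *$\delta$-synchronous over $[a,b+\delta]$* if it is so at every time $t\in[a,b]$. **Lemma (Liveness II).** Let $\delta>0$ and let $T$ be a time. Suppose that the network is $\delta$-synchronous over $[T,\;T+\Delta_{\mathrm{timeout}}+3\delta]$, and that at time $T$ some honest replica is in slot $v$ and all other honest replicas (all of them having started) are in slot $v$ or a previous slot. Then every honest replica exits slot $v$ before time $T+\Delta_{\mathrm{timeout}}+3\delta$, at a moment at which it has a block for slot $v$ in its complete block tree or a timeout certificate for slot $v$ in its pool. -/

import Mathlib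

namespace Kudzu

/-! ### Information dispersal: erasure codes, Merkle trees, blocks -/

/-- Payloads of blocks and fragments are bit strings. -/
abbrev BitStr : Type := List Bool

/-- A `(k, d)`-erasure code: a message is encoded as `k` fragments, the size of which is a function
of the length of the message, and any `d` fragments, together with the length `β` of the message,
determine it.  Reconstruction may fail (`none`); if it succeeds on fragments of the right size, it
returns a message of length `β` the encoding of which agrees with the given fragments. -/
structure ErasureCode (k d : ℕ) where
  fragLen : ℕ → ℕ
  encode : BitStr → Fin k → BitStr
  /-- `reconstruct β I fr` works on the fragments `fr i`, `i ∈ I`. -/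
  reconstruct : ℕ → Finset (Fin k) → (Fin k → BitStr) → Option BitStr
  length_encode : ∀ M i, (encode M i).length = fragLen M.length
  reconstruct_encode : ∀ (M : BitStr) (I : Finset (Fin k)) (fr : Fin k → BitStr), I.card = d →
    (∀ i ∈ I, fr i = encode M i) → reconstruct M.length I fr = some M
  reconstruct_sound : ∀ (β : ℕ) (I : Finset (Fin k)) (fr : Fin k → BitStr) (M : BitStr),
    I.card = d → (∀ i ∈ I, (fr i).length = fragLen β) → reconstruct β I fr = some M →
    M.length = β ∧ ∀ i ∈ I, encode M i = fr i

/-- A tag `(β, r)`: the length of a payload and the Merkle root of its fragments. -/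
abbrev Tag (H : Type*) : Type _ := ℕ × H

/-- Blocks, with hash values in `H`.  `regular v τ h` is `Block(v, τ, h)`, where `h = none` says
that the parent is the genesis block; `timeout v` is the timeout block `Block(v, ⊥, ⊥)`. -/
inductive Block (H : Type*) where
  | regular (slot : ℕ) (tag : Tag H) (parent : Option H)
  | timeout (slot : ℕ)

/-- The slot of a block. -/
def Block.slot {H : Type*} : Block H → ℕ
  | .regular v _ _ => v
  | .timeout v => v

/-- The block is not a timeout block. -/
def Block.IsRegular {H : Type*} : Block H → Prop
  | .regular _ _ _ => True
  | .timeout _ => False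

/-- What the hash function is applied to: fragments (leaves of Merkle trees), pairs of hash values
(inner nodes of Merkle trees), and blocks. -/
inductive HashInput (H : Type*) where
  | leaf (fragment : BitStr)
  | node (left right : H)
  | block (B : Block H)

/-- A fragment together with a validation path. -/
abbrev CertFrag (H : Type*) : Type _ := BitStr × List H

/-- A path of blocks with their payloads; the head of the list is the last block, and the list ends
at a child of the genesis block.  The empty path stands for the genesis block itself. -/
abbrev Path (H : Type*) : Type _ := List (Block H × BitStr)

/-- The parameters of the protocol.  There are `n` replicas, at most `f` of them corrupt.  Collision
resistance of the hash function is idealized: there are no collisions. `valid` is the correctness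
predicate for the payload of the last block of a path; it may depend on the whole path. -/
structure Protocol (H : Type*) where
  n : ℕ
  f : ℕ
  p : ℕ
  one_le_f : 1 ≤ f
  n_ge : 3 * f + 2 * p + 1 ≤ n
  /-- the duration `Δ_timeout` -/
  Δ : ℝ
  Δ_nonneg : 0 ≤ Δ
  leader : ℕ → Fin n
  hash : HashInput H → H
  hash_injective : Function.Injective hash
  code : ErasureCode n (f + p + 1)
  valid : Path H → Prop

variable {H : Type*} (K : Protocol H)

/-- The node at position `idx` of the given level of the Merkle tree with leaves `leaf`; level `0`
consists of the leaves. -/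
def merkleNode (leaf : ℕ → H) : ℕ → ℕ → H
  | 0, idx => leaf idx
  | l + 1, idx =>
      K.hash (.node (merkleNode leaf l (2 * idx)) (merkleNode leaf l (2 * idx + 1)))

/-- The depth of a full binary tree with at least `n` leaves. -/
def merkleDepth : ℕ := Nat.clog 2 K.n

/-- The leaves of the Merkle tree for a vector of fragments: the hashes of the fragments, padded
with hashes of the empty string. -/
def merkleLeaf (fr : Fin K.n → BitStr) (i : ℕ) : H :=
  K.hash (.leaf (if h : i < K.n then fr ⟨i, h⟩ else []))

def merkleRoot (fr : Fin K.n → BitStr) : H :=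
  merkleNode K (merkleLeaf K fr) (merkleDepth K) 0

/-- The sibling of position `i` within its level. -/
def sibling (i : ℕ) : ℕ := if i % 2 = 0 then i + 1 else i - 1

/-- The validation path for position `i`: the siblings of all nodes on the way from the leaf to the
root. -/
def merklePath (fr : Fin K.n → BitStr) (i : Fin K.n) : List H :=
  (List.range (merkleDepth K)).map fun l =>
    merkleNode K (merkleLeaf K fr) l (sibling ((i : ℕ) / 2 ^ l))

/-- Recomputation of the root from a node `h` at position `i` and the siblings on the way up. -/
def recompute : ℕ → H → List H → H
  | _, h, [] => h
  | i, h, s :: π =>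
      recompute (i / 2) (if i % 2 = 0 then K.hash (.node h s) else K.hash (.node s h)) π

/-- `cf` is a certified fragment for the tag `τ` at position `i`. -/
def Certified (τ : Tag H) (i : Fin K.n) (cf : CertFrag H) : Prop :=
  cf.1.length = K.code.fragLen τ.1 ∧
    cf.2.length = merkleDepth K ∧ recompute K i (K.hash (.leaf cf.1)) cf.2 = τ.2

/-- The tag computed by `Encode`. -/
def encodeTag (M : BitStr) : Tag H := (M.length, merkleRoot K (K.code.encode M))

/-- The certified fragments computed by `Encode`. -/
def encodeFrag (M : BitStr) (i : Fin K.n) : CertFrag H :=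
  (K.code.encode M i, merklePath K (K.code.encode M) i)

open Classical in
/-- `Decode`, applied to a tag and the certified fragments `cf i`, `i ∈ I`. -/
noncomputable def decode (τ : Tag H) (I : Finset (Fin K.n)) (cf : Fin K.n → CertFrag H) :
    Option BitStr :=
  match K.code.reconstruct τ.1 I (fun i => (cf i).1) with
  | none => none
  | some M => if merkleRoot K (K.code.encode M) = τ.2 then some M else none

/-- The hash of the last block of a path (`none` for the genesis block). -/
def Path.hash : Path H → Option H
  | [] => none
  | (B, _) :: _ => some (K.hash (.block B))

/-- The slot of the last block of a path (`0` for the genesis block). -/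
def Path.slot : Path H → ℕ
  | [] => 0
  | (B, _) :: _ => B.slot

/-! ### Signatures and messages -/

/-- The objects on which replicas issue signature shares:
`Notar(B)`, `First(B)` and `Final(B)`. -/
inductive Signable (H : Type*) where
  | notar (B : Block H)
  | first (B : Block H)
  | final (B : Block H)

/-- The messages of the protocol.  Signatures are symbolic: the argument `signer` of a vote stands
for the signature shares of that replica which the vote contains (on `Notar(B)` for a notarization
vote, on `First(B)` and `Notar(B)` for a first vote, on `Final(B)` for a finalization vote), and
`cert σ` is a signature certificate on `σ`. A first vote contains a notarization vote, with its
fragment `frag`; in a vote for a timeout block `frag` is `none`. -/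
inductive Msg (n : ℕ) (H : Type*) where
  | blockProp (B : Block H) (frag : CertFrag H)
  | notarVote (signer : Fin n) (B : Block H) (frag : Option (CertFrag H))
  | firstVote (signer : Fin n) (B : Block H) (frag : Option (CertFrag H))
  | finalVote (signer : Fin n) (B : Block H)
  | cert (σ : Signable H)

/-- The number of shares that make up a certificate. -/
def threshold : Signable H → ℕ
  | .notar _ => K.n - K.f - K.p
  | .first _ => K.n - K.p
  | .final _ => K.n - K.f - K.p

/-- There are notarization certificates for all blocks (those for timeout blocks are the timeout
certificates), and fast finalization and finalization certificates for regular blocks only. -/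
def Certifiable : Signable H → Prop
  | .notar _ => True
  | .first B => B.IsRegular
  | .final B => B.IsRegular

/-- The fragment in a notarization vote of replica `i` for `B` is as it should be. -/
def FragOk (B : Block H) (i : Fin K.n) (frag : Option (CertFrag H)) : Prop :=
  match B with
  | .regular _ τ _ => ∃ cf, frag = some cf ∧ Certified K τ i cf
  | .timeout _ => frag = none

/-! ### The state of a replica -/

/-- The local state of a replica.  `slot = 0` says that the replica has not started yet. -/
structure LState (n : ℕ) (H : Type*) where
  /-- all messages received so far, with their senders; they include the votes in the pool -/
  received : Set (Fin n × Msg n H)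
  /-- the certificates in the pool -/
  certs : Set (Signable H)
  /-- the complete block tree, each node of which is given by the path that leads to it -/
  tree : Set (Path H)
  /-- the slot of the current loop iteration -/
  slot : ℕ
  /-- the path to the block `B_p` that the next proposal extends -/
  parent : Path H
  tstart : ℝ
  proposed : Prop
  firstVoted : Prop
  notarized : Set (Block H)
  secondLook : Set (Block H)
  firstVote : Fin n → Option (Block H)

/-- The state before the start: the block tree consists of the genesis block. -/
def LState.init (n : ℕ) (H : Type*) : LState n H where
  received := ∅
  certs := ∅
  tree := {[]}
  slot := 0
  parent := []
  tstart := 0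
  proposed := False
  firstVoted := False
  notarized := ∅
  secondLook := ∅
  firstVote := fun _ => none

/-- Enter the loop iteration for the next slot, with local clock reading `now`. -/
def LState.next {n : ℕ} (s : LState n H) (now : ℝ) : LState n H :=
  { s with
    slot := s.slot + 1
    tstart := now
    proposed := False
    firstVoted := False
    notarized := ∅
    secondLook := ∅
    firstVote := fun _ => none }

/-- Receive the message `m` from `src`. -/
def LState.receive {n : ℕ} (s : LState n H) (src : Fin n) (m : Msg n H) : LState n H :=
  { s with received := insert (src, m) s.received }

/-- Block `B` is in the complete block tree. -/
def LState.HasBlock {n : ℕ} (s : LState n H) (B : Block H) : Prop :=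
  ∃ M path, (B, M) :: path ∈ s.tree

/-- The timeout certificate for slot `v` is in the pool. -/
def LState.HasTimeoutCert {n : ℕ} (s : LState n H) (v : ℕ) : Prop :=
  Signable.notar (.timeout v) ∈ s.certs

section
variable (s : LState K.n H)

/-- A valid first vote of replica `i` for `B` has been received. -/
def HasFirstVote (i : Fin K.n) (B : Block H) (frag : Option (CertFrag H)) : Prop :=
  FragOk K B i frag ∧ ∃ src, (src, Msg.firstVote i B frag) ∈ s.received

/-- A valid notarization vote of replica `i` for `B` has been received, possibly inside a first
vote. -/
def HasNotarVote (i : Fin K.n) (B : Block H) (frag : Option (CertFrag H)) : Prop :=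
  FragOk K B i frag ∧ ∃ src,
    (src, Msg.notarVote i B frag) ∈ s.received ∨ (src, Msg.firstVote i B frag) ∈ s.received

/-- The received votes contain a signature share of replica `i` on `σ`. -/
def HasShare (i : Fin K.n) : Signable H → Prop
  | .notar B => ∃ frag, HasNotarVote K s i B frag
  | .first B => ∃ frag, HasFirstVote K s i B frag
  | .final B => ∃ src, (src, Msg.finalVote i B) ∈ s.received

/-- Decoding `f + p + 1` of the fragments received in notarization votes for `B`, whose tag is `τ`,
gives `result`. -/
def Reconstructs (B : Block H) (τ : Tag H) (result : Option BitStr) : Prop :=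
  ∃ (I : Finset (Fin K.n)) (cf : Fin K.n → CertFrag H), I.card = K.f + K.p + 1 ∧
    (∀ i ∈ I, HasNotarVote K s i B (some (cf i))) ∧ decode K τ I cf = result

/-- The validation of a block proposal by replica `P`. -/
def ValidProposal (P : Fin K.n) (B : Block H) (cf : CertFrag H) : Prop :=
  ∃ τ h, B = .regular s.slot τ h ∧ Certified K τ P cf ∧
    ∃ path ∈ s.tree, Path.hash K path = h ∧ Path.slot path < s.slot ∧
      ∀ u, Path.slot path < u → u < s.slot → s.HasTimeoutCert u

end

section
variable {n : ℕ}

/-- The number of votes for `B` in the map. -/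
noncomputable def countVotes (fv : Fin n → Option (Block H)) (B : Block H) : ℕ :=
  {i | fv i = some B}.ncard

noncomputable def allVotes (fv : Fin n → Option (Block H)) : ℕ := {i | fv i ≠ none}.ncard

noncomputable def maxVotes (fv : Fin n → Option (Block H)) : ℕ :=
  sSup {k | ∃ B : Block H, B.IsRegular ∧ k = countVotes fv B}

/-- A message sent to all replicas (the sender included). -/
def broadcast (m : Msg n H) : Set (Fin n × Msg n H) := {x | x.2 = m}

end

def manyVotes (fv : Fin K.n → Option (Block H)) : Set (Block H) :=
  {B | B.IsRegular ∧ K.f + K.p + 1 ≤ countVotes fv B}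

/-! ### The steps of an honest replica -/

/-- `LocalStep K P now s out sgn s'`: replica `P`, having started, in state `s` and with local clock
reading `now`, can execute one atomic action of the protocol, which sends the messages in `out`
(pairs of a recipient and a message), issues signature shares on the objects in `sgn`, and leads to
the state `s'`.

Replicas react instantaneously, so the guard `clock() > T_start + Δ_timeout` triggers an action at
the moment from which on it is true, that is, when the clock reaches `T_start + Δ_timeout`. -/
inductive LocalStep (P : Fin K.n) (now : ℝ) (s : LState K.n H) :
    Set (Fin K.n × Msg K.n H) → Set (Signable H) → LState K.n H → Prop
  /-- The pool: a certificate is received, or generated from votes, and broadcast. -/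
  | addCert (σ : Signable H) (started : 1 ≤ s.slot) (ok : Certifiable σ) (new : σ ∉ s.certs)
      (available : (∃ src, (src, Msg.cert σ) ∈ s.received) ∨
        threshold K σ ≤ {i | HasShare K s i σ}.ncard) :
      LocalStep P now s (broadcast (.cert σ)) ∅ { s with certs := insert σ s.certs }
  /-- The complete block tree: a block is added. -/
  | addBlock (v : ℕ) (τ : Tag H) (h : Option H) (M : BitStr) (path : Path H)
      (started : 1 ≤ s.slot)
      (cert : Signable.notar (.regular v τ h) ∈ s.certs)
      (parent : path ∈ s.tree) (parent_hash : Path.hash K path = h)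
      (payload : Reconstructs K s (.regular v τ h) τ (some M))
      (valid : K.valid ((.regular v τ h, M) :: path))
      (new : (.regular v τ h, M) :: path ∉ s.tree) :
      LocalStep P now s ∅ ∅ { s with tree := insert ((.regular v τ h, M) :: path) s.tree }
  /-- The slot is exited with a block in the tree; a finalization vote for the block is broadcast
  if no other block has been notarized. -/
  | exitBlock (B : Block H) (M : BitStr) (path : Path H) (started : 1 ≤ s.slot)
      (slot : B.slot = s.slot) (mem : (B, M) :: path ∈ s.tree) :
      LocalStep P now s {x | s.notarized ⊆ {B} ∧ x ∈ broadcast (.finalVote P B)}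
        {σ | s.notarized ⊆ {B} ∧ σ = .final B} { s.next now with parent := (B, M) :: path }
  /-- The slot is exited with a timeout certificate. -/
  | exitTimeout (started : 1 ≤ s.slot) (cert : s.HasTimeoutCert s.slot) :
      LocalStep P now s ∅ ∅ (s.next now)
  /-- The leader proposes a block with a payload that validly extends the path to its parent. -/
  | propose (M : BitStr) (started : 1 ≤ s.slot) (not_proposed : ¬ s.proposed)
      (leader : K.leader s.slot = P)
      (valid : K.valid
        ((.regular s.slot (encodeTag K M) (Path.hash K s.parent), M) :: s.parent)) :
      LocalStep P now s
        {x | x.2 = .blockProp (.regular s.slot (encodeTag K M) (Path.hash K s.parent))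
          (encodeFrag K M x.1)} ∅ { s with proposed := True }
  /-- First vote for a block proposed by the leader. -/
  | firstVoteBlock (B : Block H) (cf : CertFrag H) (started : 1 ≤ s.slot)
      (not_voted : ¬ s.firstVoted)
      (received : (K.leader s.slot, Msg.blockProp B cf) ∈ s.received)
      (valid : ValidProposal K s P B cf) :
      LocalStep P now s (broadcast (.firstVote P B (some cf))) {.first B, .notar B}
        { s with firstVoted := True, notarized := insert B s.notarized }
  /-- First vote for the timeout block. -/
  | firstVoteTimeout (started : 1 ≤ s.slot) (not_voted : ¬ s.firstVoted)
      (elapsed : s.tstart + K.Δ ≤ now) :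
      LocalStep P now s (broadcast (.firstVote P (.timeout s.slot) none))
        {.first (.timeout s.slot), .notar (.timeout s.slot)}
        { s with firstVoted := True, notarized := insert (.timeout s.slot) s.notarized }
  /-- The map of first votes is updated. -/
  | recordFirstVote (i : Fin K.n) (B : Block H) (frag : Option (CertFrag H))
      (started : 1 ≤ s.slot) (slot : B.slot = s.slot) (received : HasFirstVote K s i B frag)
      (new : s.firstVote i = none) :
      LocalStep P now s ∅ ∅ { s with firstVote := Function.update s.firstVote i (some B) }
  /-- Second look at a block, with reconstruction of a valid payload. -/
  | secondLookNotarize (τ : Tag H) (h : Option H) (M : BitStr) (path : Path H)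
      (started : 1 ≤ s.slot) (voted : s.firstVoted)
      (many : .regular s.slot τ h ∈ manyVotes K s.firstVote)
      (new : .regular s.slot τ h ∉ s.secondLook)
      (parent : path ∈ s.tree) (parent_hash : Path.hash K path = h)
      (payload : Reconstructs K s (.regular s.slot τ h) τ (some M))
      (valid : K.valid ((.regular s.slot τ h, M) :: path)) :
      LocalStep P now s
        {x | .regular s.slot τ h ∉ s.notarized ∧
          x ∈ broadcast (.notarVote P (.regular s.slot τ h) (some (encodeFrag K M P)))}
        {σ | .regular s.slot τ h ∉ s.notarized ∧ σ = .notar (.regular s.slot τ h)}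
        { s with
          secondLook := insert (.regular s.slot τ h) s.secondLook
          notarized := insert (.regular s.slot τ h) s.notarized }
  /-- Second look at a block, where reconstruction fails or gives an invalid payload. -/
  | secondLookTimeout (τ : Tag H) (h : Option H) (result : Option BitStr) (path : Path H)
      (started : 1 ≤ s.slot) (voted : s.firstVoted)
      (many : .regular s.slot τ h ∈ manyVotes K s.firstVote)
      (new : .regular s.slot τ h ∉ s.secondLook)
      (parent : path ∈ s.tree) (parent_hash : Path.hash K path = h)
      (payload : Reconstructs K s (.regular s.slot τ h) τ result)
      (invalid : ∀ M, result = some M → ¬ K.valid ((.regular s.slot τ h, M) :: path)) :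
      LocalStep P now s
        {x | .timeout s.slot ∉ s.notarized ∧
          x ∈ broadcast (.notarVote P (.timeout s.slot) none)}
        {σ | .timeout s.slot ∉ s.notarized ∧ σ = .notar (.timeout s.slot)}
        { s with
          secondLook := insert (.regular s.slot τ h) s.secondLook
          notarized := insert (.timeout s.slot) s.notarized }
  /-- Timeout vote because the first votes are split (`allVotes - maxVotes ≥ f + p + 1`). -/
  | splitTimeout (started : 1 ≤ s.slot) (voted : s.firstVoted)
      (split : maxVotes s.firstVote + (K.f + K.p + 1) ≤ allVotes s.firstVote)
      (new : .timeout s.slot ∉ s.notarized) :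
      LocalStep P now s (broadcast (.notarVote P (.timeout s.slot) none))
        {.notar (.timeout s.slot)}
        { s with notarized := insert (.timeout s.slot) s.notarized }

/-! ### Executions -/

/-- A configuration of the whole system: the local states (meaningful for honest replicas only), the
messages sent by honest replicas so far (sender, recipient, message), and the signature shares
issued by honest replicas so far. -/
structure Config (n : ℕ) (H : Type*) where
  loc : Fin n → LState n H
  sent : Set (Fin n × Fin n × Msg n H)
  signed : Set (Fin n × Signable H)

def Config.init (n : ℕ) (H : Type*) : Config n H where
  loc := fun _ => LState.init n H
  sent := ∅
  signed := ∅

/-- What the adversary can send.  Signature shares of honest replicas cannot be forged, and a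
certificate with threshold `k` exists only if `k - f'` honest replicas have issued shares, where
`f'` is the number of corrupt replicas (quorum size property). -/
def Feasible (corrupt : Finset (Fin K.n)) (signed : Set (Fin K.n × Signable H)) :
    Msg K.n H → Prop
  | .blockProp _ _ => True
  | .notarVote i B _ => i ∉ corrupt → (i, .notar B) ∈ signed
  | .firstVote i B _ => i ∉ corrupt → (i, .first B) ∈ signed ∧ (i, .notar B) ∈ signed
  | .finalVote i B => i ∉ corrupt → (i, .final B) ∈ signed
  | .cert σ => threshold K σ ≤ {i | i ∉ corrupt ∧ (i, σ) ∈ signed}.ncard + corrupt.card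

/-- The steps of the system at time `t`; the local clock of replica `P` reads `t + offset P`. -/
inductive Step (corrupt : Finset (Fin K.n)) (offset : Fin K.n → ℝ) (t : ℝ)
    (c : Config K.n H) : Config K.n H → Prop
  | idle : Step corrupt offset t c c
  /-- An honest replica starts and enters slot `1`. -/
  | start (P : Fin K.n) (honest : P ∉ corrupt) (not_started : (c.loc P).slot = 0) :
      Step corrupt offset t c
        { c with loc := Function.update c.loc P ((c.loc P).next (t + offset P)) }
  /-- An honest replica receives a message.  Channels are authenticated. -/
  | deliver (src dst : Fin K.n) (m : Msg K.n H) (honest : dst ∉ corrupt)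
      (from_honest : src ∉ corrupt → (src, dst, m) ∈ c.sent)
      (from_corrupt : src ∈ corrupt → Feasible K corrupt c.signed m) :
      Step corrupt offset t c
        { c with loc := Function.update c.loc dst ((c.loc dst).receive src m) }
  /-- An honest replica executes an action of the protocol. -/
  | act (P : Fin K.n) (honest : P ∉ corrupt) (out : Set (Fin K.n × Msg K.n H))
      (sgn : Set (Signable H)) (s' : LState K.n H)
      (step : LocalStep K P (t + offset P) (c.loc P) out sgn s') :
      Step corrupt offset t c
        { loc := Function.update c.loc P s'
          sent := c.sent ∪ {x | x.1 = P ∧ x.2 ∈ out}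
          signed := c.signed ∪ {x | x.1 = P ∧ x.2 ∈ sgn} }

/-- A timed sequence of configurations; the step from `cfg k` to `cfg (k + 1)` takes place at
`time k`. -/
structure Trace (n : ℕ) (H : Type*) where
  cfg : ℕ → Config n H
  time : ℕ → ℝ

/-- The configuration at time `t`, after all steps up to and including time `t`. -/
noncomputable def Trace.at {n : ℕ} (tr : Trace n H) (t : ℝ) : Config n H :=
  tr.cfg (sInf {k | t < tr.time k})

/-- An execution of the protocol with a static set of at most `f` corrupt replicas. -/
structure Execution extends Trace K.n H where
  corrupt : Finset (Fin K.n)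
  card_corrupt : corrupt.card ≤ K.f
  offset : Fin K.n → ℝ
  init : cfg 0 = Config.init K.n H
  time_mono : Monotone time
  time_unbounded : ∀ t, ∃ k, t < time k
  step : ∀ k, Step K corrupt offset (time k) (cfg k) (cfg (k + 1))
  /-- Honest replicas react instantaneously: once everything that happens at time `t` has happened,
  no action of an honest replica is enabled. -/
  urgent : ∀ t, ∀ P ∉ corrupt, ∀ out sgn s',
    ¬ LocalStep K P (t + offset P) ((toTrace.at t).loc P) out sgn s'

variable {K}

/-- The local state of replica `P` at time `t`. -/
noncomputable def Execution.stateAt (E : Execution K) (P : Fin K.n) (t : ℝ) : LState K.n H :=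
  (E.toTrace.at t).loc P

/-- The network is `δ`-synchronous at time `t`: every message sent from an honest replica to an
honest replica at or before time `t` is received before time `t + δ`. -/
def Execution.SynchronousAt (E : Execution K) (δ t : ℝ) : Prop :=
  ∀ P ∉ E.corrupt, ∀ Q ∉ E.corrupt, ∀ m, (P, Q, m) ∈ (E.toTrace.at t).sent →
    ∃ u, u < t + δ ∧ (P, m) ∈ (E.stateAt Q u).received

/-- The network is `δ`-synchronous over the interval `[a, b + δ]`, where `c = b + δ`. -/
def Execution.SynchronousOver (E : Execution K) (δ a c : ℝ) : Prop :=
  ∀ b, c = b + δ → ∀ t, a ≤ t → t ≤ b → E.SynchronousAt δ t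

/-- Replica `P` exits slot `v` at time `t`, having a block for slot `v` in its complete block
tree. -/
def Execution.ExitsWithBlock (E : Execution K) (P : Fin K.n) (v : ℕ) (t : ℝ) : Prop :=
  ∃ k, E.time k = t ∧ ((E.cfg k).loc P).slot = v ∧ ((E.cfg (k + 1)).loc P).slot = v + 1 ∧
    ∃ B : Block H, B.slot = v ∧ ((E.cfg k).loc P).HasBlock B

/-- Replica `P` exits slot `v` at time `t`, having a timeout certificate for slot `v` in its
pool. -/
def Execution.ExitsWithTimeout (E : Execution K) (P : Fin K.n) (v : ℕ) (t : ℝ) : Prop :=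
  ∃ k, E.time k = t ∧ ((E.cfg k).loc P).slot = v ∧ ((E.cfg (k + 1)).loc P).slot = v + 1 ∧
    ((E.cfg k).loc P).HasTimeoutCert v

end Kudzu

namespace Kudzu

variable {H : Type*} {K : Protocol H}

/-! ### Merkle trees and information dispersal -/

/-! The proof waits for three deliveries and one timeout. By some `u₀ < T + δ` everything `A` had
sent by time `T` has arrived, so all honest replicas have reached slot `v`. If all are still there
at `u₀ + Δ`, their timers have run out and all have first-voted. These votes arrive by some `u₁ < u₀
+ Δ + δ`; if nobody has left by then, the honest replicas have cast notarization votes that agree.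
These arrive by some `u₂ < u₁ + δ`, produce a certificate and end the slot. If somebody has left `v`
at one of the checkpoints, the others follow within one delivery (`Delivered.slot_le`). The total is
less than `Δ + 3δ`.

Catching up works because a block in an honest tree has a notarization certificate. At least `n - f
- p - f' ≥ f + p + 1` honest replicas stand behind it, and each broadcast its fragment together with
its share. Hence every honest replica can rebuild the block (`Delivered.tree_subset`).

The crux is the agreement of the votes (`notarized_cases`). Either the honest first votes are so
split that every replica sees the split, and all vote for the timeout block; or some regular block
has at least `f + p + 1` honest first votes, and all take a second look at it. A second look has the
same outcome everywhere: Merkle roots bind fragments, so the decoded payload depends on the tag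
alone, and the parent hash determines the whole path with its payloads, hence also validity.

Eventualities come from `Execution.urgent`: once the steps at a given time are over, no action is
enabled. To show that an action has been taken, suppose that it has not; it would then still be
enabled. -/

theorem merkleNode_succ_half (leaf : ℕ → H) (l i : ℕ) :
    merkleNode K leaf (l + 1) (i / 2) =
      if i % 2 = 0 then K.hash (.node (merkleNode K leaf l i) (merkleNode K leaf l (sibling i)))
      else K.hash (.node (merkleNode K leaf l (sibling i)) (merkleNode K leaf l i)) := by
  rcases Nat.mod_two_eq_zero_or_one i with h | h
  · have h1 : 2 * (i / 2) = i := by omega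
    simp [merkleNode, sibling, h, h1]
  · have h1 : 2 * (i / 2) + 1 = i := by omega
    have h2 : 2 * (i / 2) = i - 1 := by omega
    simp [merkleNode, sibling, h, h1]
    simp [h2]

/-- The starting level is arbitrary because the induction strips the path from the leaf end, moving
the start one level up. -/
theorem recompute_siblings (leaf : ℕ → H) (d l i : ℕ) :
    recompute K i (merkleNode K leaf l i)
      ((List.range d).map fun j => merkleNode K leaf (l + j) (sibling (i / 2 ^ j))) =
        merkleNode K leaf (l + d) (i / 2 ^ d) := by
  induction d generalizing l i with
  | zero => simp [recompute]
  | succ d ih =>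
    rw [List.range_succ_eq_map, List.map_cons, List.map_map]
    simp only [recompute, pow_zero, Nat.div_one, Nat.add_zero]
    rw [← merkleNode_succ_half]
    have h := ih (l + 1) (i / 2)
    simp only [Nat.div_div_eq_div_mul, ← pow_succ'] at h
    rw [show l + (d + 1) = l + 1 + d by omega, ← h]
    congr 2
    funext j
    simp [show l + (j + 1) = l + 1 + j by omega]

/-- Merkle paths are binding. -/
theorem eq_merkleNode_of_recompute (leaf : ℕ → H) (π : List H) (l i : ℕ) (x : H)
    (hx : recompute K i x π = merkleNode K leaf (l + π.length) (i / 2 ^ π.length)) :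
    x = merkleNode K leaf l i := by
  induction π generalizing l i x with
  | nil => simpa [recompute] using hx
  | cons s π ih =>
    have h1 : merkleNode K leaf (l + (s :: π).length) (i / 2 ^ (s :: π).length) =
        merkleNode K leaf (l + 1 + π.length) (i / 2 / 2 ^ π.length) := by
      rw [Nat.div_div_eq_div_mul, ← pow_succ', List.length_cons,
        show l + (π.length + 1) = l + 1 + π.length by omega]
    rw [h1] at hx
    have h2 := ih (l + 1) (i / 2) _ hx
    rw [merkleNode_succ_half] at h2
    split_ifs at h2
    · have := K.hash_injective h2
      injection this
    · have := K.hash_injective h2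
      injection this

theorem div_two_pow_merkleDepth (i : Fin K.n) : (i : ℕ) / 2 ^ merkleDepth K = 0 :=
  Nat.div_eq_of_lt (i.2.trans_le (Nat.le_pow_clog (by norm_num) _))

theorem merkleLeaf_fin (fr : Fin K.n → BitStr) (i : Fin K.n) :
    merkleLeaf K fr i = K.hash (.leaf (fr i)) := by
  simp [merkleLeaf]

theorem certified_encodeFrag (M : BitStr) (i : Fin K.n) :
    Certified K (encodeTag K M) i (encodeFrag K M i) := by
  refine ⟨K.code.length_encode M i, by simp [encodeFrag, merklePath], ?_⟩
  have h := recompute_siblings (K := K) (merkleLeaf K (K.code.encode M)) (merkleDepth K) 0 i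
  rw [div_two_pow_merkleDepth] at h
  simp only [Nat.zero_add] at h
  rw [merkleNode, merkleLeaf_fin] at h
  exact h

/-- The root commits to every leaf and leaf hashes are injective, so even a corrupt replica cannot
certify a false fragment for the tag of an encoded payload. -/
theorem Certified.eq_encode {M : BitStr} {i : Fin K.n} {cf : CertFrag H}
    (h : Certified K (encodeTag K M) i cf) : cf.1 = K.code.encode M i := by
  obtain ⟨-, h2, h3⟩ := h
  have := eq_merkleNode_of_recompute (K := K) (merkleLeaf K (K.code.encode M)) cf.2 0 i
    (K.hash (.leaf cf.1)) (by
      rw [h3, h2, div_two_pow_merkleDepth, Nat.zero_add]; rfl)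
  rw [merkleNode, merkleLeaf_fin] at this
  have := K.hash_injective this
  injection this

/-- The right-hand side mentions neither the positions nor the fragments: replicas that decode from
different votes get the same result. A successful decoding has checked length and root; conversely,
certified fragments for the tag of `M` are the genuine ones. -/
theorem decode_eq_some_iff {τ : Tag H} {I : Finset (Fin K.n)} {cf : Fin K.n → CertFrag H}
    (hI : I.card = K.f + K.p + 1) (hcf : ∀ i ∈ I, Certified K τ i (cf i)) (M : BitStr) :
    decode K τ I cf = some M ↔ encodeTag K M = τ := by
  constructor
  · intro h
    unfold decode at h
    split at h
    · cases h
    · rename_i M' hM'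
      split_ifs at h with hr
      cases h
      have := (K.code.reconstruct_sound _ _ _ _ hI (fun i hi => (hcf i hi).1) hM').1
      exact Prod.ext this hr
  · rintro rfl
    have := K.code.reconstruct_encode M I (fun i => (cf i).1) hI
      fun i hi => (hcf i hi).eq_encode
    unfold decode
    rw [show (encodeTag K M).1 = M.length from rfl, this]
    simp [encodeTag]

theorem fault_bound_le (K : Protocol H) : K.f + K.p + 1 ≤ K.n := by
  have := K.n_ge
  omega

/-- Decoding one and the same choice of `f + p + 1` fragments must return both payloads. -/
theorem encodeTag_injective : Function.Injective (encodeTag K) := by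
  intro M M' h
  obtain ⟨I, -, hI⟩ := Finset.exists_subset_card_eq
    (s := (Finset.univ : Finset (Fin K.n))) (n := K.f + K.p + 1)
    (by simpa using fault_bound_le K)
  have hc : ∀ i ∈ I, Certified K (encodeTag K M) i (encodeFrag K M i) :=
    fun i _ => certified_encodeFrag M i
  have h1 := (decode_eq_some_iff hI hc M).2 rfl
  have h2 := (decode_eq_some_iff hI hc M').2 h.symm
  rw [h1] at h2
  exact Option.some.inj h2

theorem certified_of_hasNotarVote {s : LState K.n H} {i : Fin K.n} {v : ℕ} {τ : Tag H}
    {h : Option H} {cf : CertFrag H} (hv : HasNotarVote K s i (.regular v τ h) (some cf)) :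
    Certified K τ i cf := by
  obtain ⟨cf', h1, h2⟩ := hv.1
  cases h1
  exact h2

/-- The result of a reconstruction depends on the tag only. -/
theorem Reconstructs.eq_some_iff {s : LState K.n H} {v : ℕ} {τ : Tag H} {h : Option H}
    {result : Option BitStr} (hr : Reconstructs K s (.regular v τ h) τ result) (M : BitStr) :
    result = some M ↔ encodeTag K M = τ := by
  obtain ⟨I, cf, hI, hv, rfl⟩ := hr
  exact decode_eq_some_iff hI (fun i hi => certified_of_hasNotarVote (hv i hi)) M

/-! ### Consistent paths -/

/-- Each block of the path has the tag of its payload and the hash of its predecessor. -/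
def Consistent (K : Protocol H) : Path H → Prop
  | [] => True
  | (B, M) :: path =>
      (∃ v, B = .regular v (encodeTag K M) (Path.hash K path)) ∧ Consistent K path

/-- A consistent path is determined by its hash. -/
theorem Consistent.eq_of_hash_eq {p q : Path H} (hp : Consistent K p) (hq : Consistent K q)
    (h : Path.hash K p = Path.hash K q) : p = q := by
  induction p generalizing q with
  | nil =>
    cases q with
    | nil => rfl
    | cons b q => simp [Path.hash] at h
  | cons a p ih =>
    cases q with
    | nil => simp [Path.hash] at h
    | cons b q =>
      obtain ⟨B, M⟩ := a
      obtain ⟨B', M'⟩ := b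
      have hB : B = B' := by
        have := K.hash_injective (Option.some.inj h)
        injection this
      subst hB
      obtain ⟨⟨v, h1⟩, hp⟩ := hp
      obtain ⟨⟨w, h2⟩, hq⟩ := hq
      rw [h1] at h2
      injection h2 with _ h3 h4
      rw [encodeTag_injective h3, ih hp hq h4]

/-- There is a valid payload for the block with the given slot, tag and parent hash. -/
def PayloadValid (K : Protocol H) (v : ℕ) (τ : Tag H) (h : Option H) : Prop :=
  ∃ M path, Consistent K path ∧ Path.hash K path = h ∧ encodeTag K M = τ ∧
    K.valid ((.regular v τ h, M) :: path)

/-! ### Monotonicity of the local state -/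

/-- What persists from an earlier local state to a later one. -/
structure LState.Le {n : ℕ} (s s' : LState n H) : Prop where
  received : s.received ⊆ s'.received
  certs : s.certs ⊆ s'.certs
  tree : s.tree ⊆ s'.tree
  slot : s.slot ≤ s'.slot
  tstart : s.slot = s'.slot → s.tstart = s'.tstart
  firstVoted : s.slot = s'.slot → s.firstVoted → s'.firstVoted
  notarized : s.slot = s'.slot → s.notarized ⊆ s'.notarized

theorem LState.Le.refl {n : ℕ} (s : LState n H) : s.Le s :=
  ⟨subset_rfl, subset_rfl, subset_rfl, le_rfl, fun _ => rfl, fun _ => id, fun _ => subset_rfl⟩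

theorem LState.Le.trans {n : ℕ} {s₁ s₂ s₃ : LState n H} (h : s₁.Le s₂) (h' : s₂.Le s₃) :
    s₁.Le s₃ := by
  -- Slots never decrease, so equal slots at both ends force the same slot in between.
  have key : s₁.slot = s₃.slot → s₁.slot = s₂.slot ∧ s₂.slot = s₃.slot := fun e => by
    have := h.slot
    have := h'.slot
    omega
  exact ⟨h.received.trans h'.received, h.certs.trans h'.certs, h.tree.trans h'.tree,
    h.slot.trans h'.slot, fun e => (h.tstart (key e).1).trans (h'.tstart (key e).2),
    fun e x => h'.firstVoted (key e).2 (h.firstVoted (key e).1 x),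
    fun e => (h.notarized (key e).1).trans (h'.notarized (key e).2)⟩

theorem LState.le_next {n : ℕ} (s : LState n H) (now : ℝ) : s.Le (s.next now) :=
  ⟨subset_rfl, subset_rfl, subset_rfl, Nat.le_succ _, fun e => by simp [LState.next] at e,
    fun e => by simp [LState.next] at e, fun e => by simp [LState.next] at e⟩

theorem LState.le_receive {n : ℕ} (s : LState n H) (src : Fin n) (m : Msg n H) :
    s.Le (s.receive src m) :=
  ⟨Set.subset_insert _ _, subset_rfl, subset_rfl, le_rfl, fun _ => rfl, fun _ => id,
    fun _ => subset_rfl⟩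

theorem LocalStep.le {P : Fin K.n} {now : ℝ} {s s' : LState K.n H} {out sgn}
    (h : LocalStep K P now s out sgn s') : s.Le s' := by
  cases h with
  | addCert σ => exact { LState.Le.refl s with certs := Set.subset_insert _ _ }
  | addBlock => exact { LState.Le.refl s with tree := Set.subset_insert _ _ }
  | exitBlock => exact { s.le_next now with }
  | exitTimeout => exact s.le_next now
  | propose => exact { LState.Le.refl s with }
  | firstVoteBlock =>
    exact { LState.Le.refl s with
      firstVoted := fun _ _ => trivial, notarized := fun _ => Set.subset_insert _ _ }
  | firstVoteTimeout =>
    exact { LState.Le.refl s with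
      firstVoted := fun _ _ => trivial, notarized := fun _ => Set.subset_insert _ _ }
  | recordFirstVote => exact { LState.Le.refl s with }
  | secondLookNotarize =>
    exact { LState.Le.refl s with notarized := fun _ => Set.subset_insert _ _ }
  | secondLookTimeout =>
    exact { LState.Le.refl s with notarized := fun _ => Set.subset_insert _ _ }
  | splitTimeout =>
    exact { LState.Le.refl s with notarized := fun _ => Set.subset_insert _ _ }

/-- A replica leaves its slot for the next one, having a block or a timeout certificate. -/
theorem LocalStep.slot_cases {P : Fin K.n} {now : ℝ} {s s' : LState K.n H} {out sgn}
    (h : LocalStep K P now s out sgn s') :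
    (s'.slot = s.slot ∧ s'.tstart = s.tstart) ∨ (s'.slot = s.slot + 1 ∧ s'.tstart = now ∧
      ((∃ B : Block H, B.slot = s.slot ∧ s.HasBlock B) ∨ s.HasTimeoutCert s.slot)) := by
  cases h with
  | exitBlock B M path _ hB hm => exact .inr ⟨rfl, rfl, .inl ⟨B, hB, M, path, hm⟩⟩
  | exitTimeout _ hc => exact .inr ⟨rfl, rfl, .inr hc⟩
  | _ => exact .inl ⟨rfl, rfl⟩

/-! ### The invariant of a single honest replica -/

/-- The invariant of replica `P` in state `s`, having sent the messages in `out` and having issued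
signature shares on the objects in `sgn`. -/
structure ReplicaInv (K : Protocol H) (P : Fin K.n) (s : LState K.n H)
    (out : Set (Fin K.n × Msg K.n H)) (sgn : Set (Signable H)) : Prop where
  nil_mem : [] ∈ s.tree
  tree : ∀ B M path, (B, M) :: path ∈ s.tree → Consistent K ((B, M) :: path) ∧ path ∈ s.tree ∧
    .notar B ∈ s.certs ∧ K.valid ((B, M) :: path)
  exits : ∀ u, 1 ≤ u → u < s.slot →
    (∃ B : Block H, B.slot = u ∧ s.HasBlock B) ∨ s.HasTimeoutCert u
  recorded : ∀ i B, s.firstVote i = some B → B.slot = s.slot ∧ ∃ frag, HasFirstVote K s i B frag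
  looked : ∀ τ h, .regular s.slot τ h ∈ s.secondLook →
    (PayloadValid K s.slot τ h → .regular s.slot τ h ∈ s.notarized) ∧
      (¬ PayloadValid K s.slot τ h → .timeout s.slot ∈ s.notarized)
  certs : ∀ σ ∈ s.certs, Certifiable σ ∧ ∀ Q, (Q, .cert σ) ∈ out
  notarized : ∀ B ∈ s.notarized, .notar B ∈ sgn
  notar_sent : ∀ B, .notar B ∈ sgn → ∃ frag, FragOk K B P frag ∧
    ∀ Q, (Q, .notarVote P B frag) ∈ out ∨ (Q, .firstVote P B frag) ∈ out
  first_signed : ∀ B, .first B ∈ sgn → B.slot ≤ s.slot ∧ (B.slot = s.slot → s.firstVoted) ∧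
    ∀ w τ h, B = .regular w τ h → ∃ path ∈ s.tree, Path.hash K path = h
  first_voted : s.firstVoted → ∃ B frag, B.slot = s.slot ∧ .first B ∈ sgn ∧ FragOk K B P frag ∧
    ∀ Q, (Q, .firstVote P B frag) ∈ out
  first_unique : ∀ B B', .first B ∈ sgn → .first B' ∈ sgn → B.slot = B'.slot → B = B'

section
variable {P : Fin K.n} {s : LState K.n H} {out : Set (Fin K.n × Msg K.n H)}
  {sgn : Set (Signable H)}

theorem ReplicaInv.init (P : Fin K.n) : ReplicaInv K P (LState.init K.n H) ∅ ∅ where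
  nil_mem := rfl
  tree _ _ _ h := by cases h
  exits _ h h' := absurd h' (by simp [LState.init])
  recorded _ _ h := by cases h
  looked _ _ h := by cases h
  certs _ h := by cases h
  notarized _ h := by cases h
  notar_sent _ h := by cases h
  first_signed _ h := by cases h
  first_voted h := by cases h
  first_unique _ _ h := by cases h

theorem ReplicaInv.consistent (inv : ReplicaInv K P s out sgn) {path : Path H}
    (h : path ∈ s.tree) : Consistent K path := by
  cases path with
  | nil => trivial
  | cons a path => exact (inv.tree a.1 a.2 path h).1

theorem ReplicaInv.mono_out (inv : ReplicaInv K P s out sgn) {out' : Set (Fin K.n × Msg K.n H)}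
    (h : out ⊆ out') : ReplicaInv K P s out' sgn :=
  { inv with
    certs := fun σ hσ => ⟨(inv.certs σ hσ).1, fun Q => h ((inv.certs σ hσ).2 Q)⟩
    notar_sent := fun B hB => by
      obtain ⟨frag, h1, h2⟩ := inv.notar_sent B hB
      exact ⟨frag, h1, fun Q => (h2 Q).imp (@h _) (@h _)⟩
    first_voted := fun hv => by
      obtain ⟨B, frag, h1, h2, h3, h4⟩ := inv.first_voted hv
      exact ⟨B, frag, h1, h2, h3, fun Q => h (h4 Q)⟩ }

/-- The invariant looks at notarization and first-vote shares only, so finalization shares issued on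
exit do not affect it. -/
theorem ReplicaInv.congr_signed (inv : ReplicaInv K P s out sgn) {sgn' : Set (Signable H)}
    (hn : ∀ B, .notar B ∈ sgn' ↔ .notar B ∈ sgn) (hf : ∀ B, .first B ∈ sgn' ↔ .first B ∈ sgn) :
    ReplicaInv K P s out sgn' :=
  { inv with
    notarized := by simpa only [hn] using inv.notarized
    notar_sent := by simpa only [hn] using inv.notar_sent
    first_signed := by simpa only [hf] using inv.first_signed
    first_voted := by simpa only [hf] using inv.first_voted
    first_unique := by simpa only [hf] using inv.first_unique }

theorem ReplicaInv.receive (inv : ReplicaInv K P s out sgn) (src : Fin K.n) (m : Msg K.n H) :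
    ReplicaInv K P (s.receive src m) out sgn :=
  { inv with
    recorded := fun i B hB => by
      obtain ⟨h1, frag, h2, src', h3⟩ := inv.recorded i B hB
      exact ⟨h1, frag, h2, src', Set.mem_insert_of_mem _ h3⟩ }

theorem ReplicaInv.next (inv : ReplicaInv K P s out sgn) (now : ℝ)
    (hs : 1 ≤ s.slot → (∃ B : Block H, B.slot = s.slot ∧ s.HasBlock B) ∨
      s.HasTimeoutCert s.slot) :
    ReplicaInv K P (s.next now) out sgn :=
  { inv with
    exits := fun u h1 h2 => by
      rcases Nat.lt_succ_iff_lt_or_eq.1 h2 with h | rfl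
      · exact inv.exits u h1 h
      · exact hs h1
    recorded := fun _ _ h => by cases h
    looked := fun _ _ h => by cases h
    notarized := fun _ h => by cases h
    -- All earlier first-vote shares are for slots below the new one, so the clause about the
    -- current slot becomes vacuous.
    first_signed := fun B hB => by
      obtain ⟨h1, -, h3⟩ := inv.first_signed B hB
      exact ⟨h1.trans (Nat.le_succ _),
        fun e => absurd h1 (by rw [e]; simp [LState.next]), h3⟩
    first_voted := fun h => by cases h }

theorem ReplicaInv.addCert (inv : ReplicaInv K P s out sgn) (σ : Signable H)
    (ok : Certifiable σ) :
    ReplicaInv K P { s with certs := insert σ s.certs } (out ∪ broadcast (.cert σ)) sgn :=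
  { inv.mono_out (Set.subset_union_left (t := broadcast (.cert σ))) with
    tree := fun B M path h => by
      obtain ⟨h1, h2, h3, h4⟩ := inv.tree B M path h
      exact ⟨h1, h2, Set.mem_insert_of_mem _ h3, h4⟩
    exits := fun u h1 h2 => (inv.exits u h1 h2).imp id (Set.mem_insert_of_mem _)
    certs := fun σ' h => by
      rcases h with rfl | h
      · exact ⟨ok, fun Q => .inr rfl⟩
      · exact ⟨(inv.certs σ' h).1, fun Q => .inl ((inv.certs σ' h).2 Q)⟩ }

theorem ReplicaInv.addBlock (inv : ReplicaInv K P s out sgn) {B : Block H} {M : BitStr}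
    {path : Path H} (hc : Consistent K ((B, M) :: path)) (hp : path ∈ s.tree)
    (hn : .notar B ∈ s.certs) (hv : K.valid ((B, M) :: path)) :
    ReplicaInv K P { s with tree := insert ((B, M) :: path) s.tree } out sgn :=
  { inv with
    nil_mem := .inr inv.nil_mem
    tree := fun B' M' path' h => by
      rcases h with h | h
      · cases h
        exact ⟨hc, .inr hp, hn, hv⟩
      · obtain ⟨h1, h2, h3⟩ := inv.tree B' M' path' h
        exact ⟨h1, .inr h2, h3⟩
    exits := fun u h1 h2 => (inv.exits u h1 h2).imp
      (fun ⟨B', h3, M', path', h4⟩ => ⟨B', h3, M', path', .inr h4⟩) id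
    first_signed := fun B' h => by
      obtain ⟨h1, h2, h3⟩ := inv.first_signed B' h
      refine ⟨h1, h2, fun w τ h e => ?_⟩
      obtain ⟨q, hq, hq'⟩ := h3 w τ h e
      exact ⟨q, .inr hq, hq'⟩ }

theorem ReplicaInv.firstVote (inv : ReplicaInv K P s out sgn) {B : Block H}
    {frag : Option (CertFrag H)} (hB : B.slot = s.slot) (hfrag : FragOk K B P frag)
    (hnew : ¬ s.firstVoted)
    (hparent : ∀ w τ h, B = .regular w τ h → ∃ path ∈ s.tree, Path.hash K path = h) :
    ReplicaInv K P { s with firstVoted := True, notarized := insert B s.notarized }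
      (out ∪ broadcast (.firstVote P B frag)) (sgn ∪ {.first B, .notar B}) :=
  { inv.mono_out (Set.subset_union_left (t := broadcast (.firstVote P B frag))) with
    looked := fun τ h hl =>
      ⟨fun hv => .inr ((inv.looked τ h hl).1 hv), fun hv => .inr ((inv.looked τ h hl).2 hv)⟩
    notarized := fun B' h => by
      rcases h with rfl | h
      · simp
      · exact .inl (inv.notarized B' h)
    notar_sent := fun B' h => by
      rcases h with h | h
      · obtain ⟨frag, h1, h2⟩ := inv.notar_sent B' h
        exact ⟨frag, h1, fun Q => (h2 Q).imp .inl .inl⟩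
      · have : B' = B := by simpa using h
        subst this
        exact ⟨frag, hfrag, fun Q => .inr (.inr rfl)⟩
    first_signed := fun B' h => by
      rcases h with h | h
      · obtain ⟨h1, -, h3⟩ := inv.first_signed B' h
        exact ⟨h1, fun _ => trivial, h3⟩
      · have : B' = B := by simpa using h
        subst this
        exact ⟨hB.le, fun _ => trivial, hparent⟩
    first_voted := fun _ => ⟨B, frag, hB, by simp, hfrag, fun Q => .inr rfl⟩
    first_unique := fun B₁ B₂ h₁ h₂ e => by
      -- A share on a first vote issued earlier in this slot would already have set `firstVoted`.
      have key : ∀ B', .first B' ∈ sgn → B'.slot ≠ B.slot := fun B' h e =>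
        hnew ((inv.first_signed B' h).2.1 (e.trans hB))
      rcases h₁ with h₁ | h₁ <;> rcases h₂ with h₂ | h₂
      · exact inv.first_unique _ _ h₁ h₂ e
      · have : B₂ = B := by simpa using h₂
        exact absurd (e.trans (congrArg _ this)) (key _ h₁)
      · have : B₁ = B := by simpa using h₁
        exact absurd (e.symm.trans (congrArg _ this)) (key _ h₂)
      · have h1 : B₁ = B := by simpa using h₁
        have h2 : B₂ = B := by simpa using h₂
        rw [h1, h2] }

/-- The condition `B ∉ s.notarized` models that a vote is not repeated. If it fails, the invariant
already provides the share and the message of the earlier vote. -/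
theorem ReplicaInv.notarize (inv : ReplicaInv K P s out sgn) {B : Block H}
    {frag : Option (CertFrag H)} (hfrag : FragOk K B P frag) :
    ReplicaInv K P { s with notarized := insert B s.notarized }
      (out ∪ {x | B ∉ s.notarized ∧ x ∈ broadcast (.notarVote P B frag)})
      (sgn ∪ {σ | B ∉ s.notarized ∧ σ = .notar B}) :=
  { (inv.mono_out (Set.subset_union_left
      (t := {x | B ∉ s.notarized ∧ x ∈ broadcast (.notarVote P B frag)}))) with
    looked := fun τ h hl =>
      ⟨fun hv => .inr ((inv.looked τ h hl).1 hv), fun hv => .inr ((inv.looked τ h hl).2 hv)⟩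
    notarized := fun B' h => by
      by_cases hB : B' ∈ s.notarized
      · exact .inl (inv.notarized B' hB)
      · rcases h with rfl | h
        · exact .inr ⟨hB, rfl⟩
        · exact absurd h hB
    notar_sent := fun B' h => by
      rcases h with h | ⟨h0, h⟩
      · obtain ⟨frag, h1, h2⟩ := inv.notar_sent B' h
        exact ⟨frag, h1, fun Q => (h2 Q).imp .inl .inl⟩
      · cases h
        exact ⟨frag, hfrag, fun Q => .inl (.inr ⟨h0, rfl⟩)⟩
    first_signed := by simpa using inv.first_signed
    first_voted := fun hv => by
      obtain ⟨B, frag, h1, h2, h3, h4⟩ := inv.first_voted hv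
      exact ⟨B, frag, h1, .inl h2, h3, fun Q => .inl (h4 Q)⟩
    first_unique := by simpa using inv.first_unique }

/-- The substantial cases are the second looks: the field `looked` ties their outcome to
`PayloadValid`, a property of the block that does not refer to the replica. -/
theorem ReplicaInv.localStep (inv : ReplicaInv K P s out sgn) {now : ℝ} {o g}
    {s' : LState K.n H} (h : LocalStep K P now s o g s') :
    ReplicaInv K P s' (out ∪ o) (sgn ∪ g) := by
  cases h with
  | addCert σ _ ok => simpa using inv.addCert σ ok
  | addBlock v τ h M path _ cert parent parent_hash payload valid =>
    simp only [Set.union_empty]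
    refine inv.addBlock ⟨⟨v, ?_⟩, inv.consistent parent⟩ parent cert valid
    rw [(payload.eq_some_iff M).1 rfl, parent_hash]
  | exitBlock B M path _ hB hm =>
    exact { ((inv.next now fun _ => .inl ⟨B, hB, M, path, hm⟩).mono_out
      Set.subset_union_left).congr_signed (by simp) (by simp) with }
  | exitTimeout _ hc => simpa using inv.next now fun _ => .inr hc
  | propose =>
    exact { (inv.mono_out Set.subset_union_left).congr_signed (by simp) (by simp) with }
  | firstVoteBlock B cf _ hnew _ valid =>
    obtain ⟨τ, h, rfl, hcf, path, hp, hh, -⟩ := valid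
    exact inv.firstVote rfl ⟨cf, rfl, hcf⟩ hnew fun w τ h e => by
      cases e
      exact ⟨path, hp, hh⟩
  | firstVoteTimeout _ hnew =>
    exact inv.firstVote rfl rfl hnew fun w τ h e => by cases e
  | recordFirstVote i B frag _ hB hr =>
    simp only [Set.union_empty]
    exact { inv with
      recorded := fun j B' hj => by
        by_cases hij : j = i
        · subst hij
          simp only [Function.update_self, Option.some.injEq] at hj
          subst hj
          exact ⟨hB, frag, hr⟩
        · simp only [Function.update_of_ne hij] at hj
          exact inv.recorded j B' hj }
  | secondLookNotarize τ h M path _ _ _ _ parent parent_hash payload valid =>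
    have hτ := (payload.eq_some_iff M).1 rfl
    have inv' := inv.notarize (B := .regular s.slot τ h) (frag := some (encodeFrag K M P))
      ⟨_, rfl, hτ ▸ certified_encodeFrag M P⟩
    exact { inv' with
      looked := fun τ' h' hl => by
        rcases hl with hl | hl
        · cases hl
          exact ⟨fun _ => .inl rfl, fun hv => absurd
            ⟨M, path, inv.consistent parent, parent_hash, hτ, valid⟩ hv⟩
        · exact inv'.looked τ' h' hl }
  | secondLookTimeout τ h result path _ _ _ _ parent parent_hash payload invalid =>
    have inv' := inv.notarize (B := .timeout s.slot) (frag := none) rfl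
    exact { inv' with
      looked := fun τ' h' hl => by
        rcases hl with hl | hl
        · cases hl
          refine ⟨fun hv => ?_, fun _ => .inl rfl⟩
          obtain ⟨M, q, hq, hqh, hM, hval⟩ := hv
          -- Any witness of validity uses this replica's own parent path, since the parent hash
          -- determines the path; its payload is then the decoded one, which was rejected.
          have : q = path := hq.eq_of_hash_eq (inv.consistent parent)
            (hqh.trans parent_hash.symm)
          subst this
          exact absurd hval (invalid M ((payload.eq_some_iff M).2 hM))
        · exact inv'.looked τ' h' hl }
  | splitTimeout _ _ _ hnew =>
    simpa [hnew] using inv.notarize (B := .timeout s.slot) (frag := none) rfl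

end

/-! ### The invariant of a configuration -/

theorem Feasible.mono {corrupt : Finset (Fin K.n)} {signed signed' : Set (Fin K.n × Signable H)}
    (h : signed ⊆ signed') {m : Msg K.n H} (hm : Feasible K corrupt signed m) :
    Feasible K corrupt signed' m := by
  cases m with
  | blockProp => trivial
  | notarVote i B frag => exact fun hi => h (hm hi)
  | firstVote i B frag => exact fun hi => ⟨h (hm hi).1, h (hm hi).2⟩
  | finalVote i B => exact fun hi => h (hm hi)
  | cert σ =>
    refine le_trans hm (Nat.add_le_add_right (Set.ncard_le_ncard ?_ (Set.toFinite _)) _)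
    exact fun i hi => ⟨hi.1, h hi.2⟩

/-- All messages received or sent by honest replicas, and all certificates in their pools, could
have been sent by the adversary. -/
structure FeasibleInv (corrupt : Finset (Fin K.n)) (c : Config K.n H) : Prop where
  received : ∀ P ∉ corrupt, ∀ x ∈ (c.loc P).received, Feasible K corrupt c.signed x.2
  certs : ∀ P ∉ corrupt, ∀ σ ∈ (c.loc P).certs, Feasible K corrupt c.signed (.cert σ)
  sent : ∀ P ∉ corrupt, ∀ x, (P, x) ∈ c.sent → Feasible K corrupt c.signed x.2

/-- The invariant of the whole system. -/
structure ConfigInv (corrupt : Finset (Fin K.n)) (c : Config K.n H) : Prop where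
  replica : ∀ P ∉ corrupt, ReplicaInv K P (c.loc P) {x | (P, x) ∈ c.sent} {σ | (P, σ) ∈ c.signed}
  feasible : FeasibleInv corrupt c
  finite_sent : c.sent.Finite

/-- Shares of honest replicas in received votes are genuine. -/
theorem signed_of_hasShare {corrupt : Finset (Fin K.n)} {signed : Set (Fin K.n × Signable H)}
    {s : LState K.n H} (h : ∀ x ∈ s.received, Feasible K corrupt signed x.2) {i : Fin K.n}
    (hi : i ∉ corrupt) {σ : Signable H} (hs : HasShare K s i σ) : (i, σ) ∈ signed := by
  cases σ with
  | notar B =>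
    obtain ⟨frag, -, src, hm | hm⟩ := hs
    · exact h _ hm hi
    · exact (h _ hm hi).2
  | first B =>
    obtain ⟨frag, -, src, hm⟩ := hs
    exact (h _ hm hi).1
  | final B =>
    obtain ⟨src, hm⟩ := hs
    exact h _ hm hi

/-- The signers split into corrupt ones, counted by `corrupt.card`, and honest ones, whose shares
are genuine. -/
theorem feasible_cert_of_shares {corrupt : Finset (Fin K.n)}
    {signed : Set (Fin K.n × Signable H)}
    {s : LState K.n H} (h : ∀ x ∈ s.received, Feasible K corrupt signed x.2) {σ : Signable H}
    (hs : threshold K σ ≤ {i | HasShare K s i σ}.ncard) : Feasible K corrupt signed (.cert σ) := by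
  refine hs.trans ?_
  rw [← Set.ncard_coe_finset corrupt]
  refine (Set.ncard_le_ncard (fun i hi => ?_) (Set.toFinite _)).trans (Set.ncard_union_le _ _)
  by_cases hc : i ∈ corrupt
  · exact .inr hc
  · exact .inl ⟨hc, signed_of_hasShare h hc hi⟩

/-- Honest votes come with the sender's own shares, and honest certificates are relayed or assembled
from feasible messages. Thus one bound governs all messages, whoever sent them. -/
theorem LocalStep.feasible_out {corrupt : Finset (Fin K.n)}
    {signed signed' : Set (Fin K.n × Signable H)} {P : Fin K.n} {now : ℝ} {s s' : LState K.n H}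
    {out sgn} (h : LocalStep K P now s out sgn s') (hsub : signed ⊆ signed')
    (hsgn : ∀ σ ∈ sgn, (P, σ) ∈ signed')
    (hr : ∀ x ∈ s.received, Feasible K corrupt signed x.2) :
    ∀ x ∈ out, Feasible K corrupt signed' x.2 := by
  rintro ⟨Q, m⟩ hx
  cases h with
  | addCert σ _ _ _ av =>
    cases hx
    refine Feasible.mono hsub ?_
    rcases av with ⟨src, hm⟩ | hs
    · exact hr (src, _) hm
    · exact feasible_cert_of_shares hr hs
  | addBlock => cases hx
  | exitBlock B =>
    obtain ⟨h1, h2⟩ := hx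
    cases h2
    exact fun _ => hsgn _ ⟨h1, rfl⟩
  | exitTimeout => cases hx
  | propose M =>
    have hm : m = .blockProp _ (encodeFrag K M Q) := hx
    subst hm
    trivial
  | firstVoteBlock B cf =>
    cases hx
    exact fun _ => ⟨hsgn _ (by simp), hsgn _ (by simp)⟩
  | firstVoteTimeout =>
    cases hx
    exact fun _ => ⟨hsgn _ (by simp), hsgn _ (by simp)⟩
  | recordFirstVote => cases hx
  | secondLookNotarize =>
    obtain ⟨h1, h2⟩ := hx
    cases h2
    exact fun _ => hsgn _ ⟨h1, rfl⟩
  | secondLookTimeout =>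
    obtain ⟨h1, h2⟩ := hx
    cases h2
    exact fun _ => hsgn _ ⟨h1, rfl⟩
  | splitTimeout =>
    cases hx
    exact fun _ => hsgn _ rfl

theorem LocalStep.certs_subset {P : Fin K.n} {now : ℝ} {s s' : LState K.n H} {out sgn}
    (h : LocalStep K P now s out sgn s') :
    ∀ σ ∈ s'.certs, σ ∈ s.certs ∨ (∃ src, (src, Msg.cert σ) ∈ s.received) ∨
      threshold K σ ≤ {i | HasShare K s i σ}.ncard := by
  intro σ hσ
  cases h with
  | addCert σ' _ _ _ av =>
    rcases hσ with rfl | hσ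
    · exact .inr av
    · exact .inl hσ
  | _ => exact .inl hσ

theorem LocalStep.received_eq {P : Fin K.n} {now : ℝ} {s s' : LState K.n H} {out sgn}
    (h : LocalStep K P now s out sgn s') : s'.received = s.received := by
  cases h <;> rfl

theorem finite_broadcast {n : ℕ} (m : Msg n H) : (broadcast m).Finite :=
  (Set.finite_range fun Q : Fin n => (Q, m)).subset fun x hx => ⟨x.1, Prod.ext rfl hx.symm⟩

theorem LocalStep.finite_out {P : Fin K.n} {now : ℝ} {s s' : LState K.n H} {out sgn}
    (h : LocalStep K P now s out sgn s') : out.Finite := by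
  cases h with
  | addCert σ => exact finite_broadcast _
  | addBlock => exact Set.finite_empty
  | exitBlock => exact (finite_broadcast _).subset fun x hx => hx.2
  | exitTimeout => exact Set.finite_empty
  | propose M =>
    refine (Set.finite_range fun Q : Fin K.n => (Q, Msg.blockProp (n := K.n) (.regular s.slot
      (encodeTag K M) (Path.hash K s.parent)) (encodeFrag K M Q))).subset fun x hx => ?_
    exact ⟨x.1, Prod.ext rfl hx.symm⟩
  | firstVoteBlock => exact finite_broadcast _
  | firstVoteTimeout => exact finite_broadcast _
  | recordFirstVote => exact Set.finite_empty
  | secondLookNotarize => exact (finite_broadcast _).subset fun x hx => hx.2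
  | secondLookTimeout => exact (finite_broadcast _).subset fun x hx => hx.2
  | splitTimeout => exact finite_broadcast _

theorem ConfigInv.init (corrupt : Finset (Fin K.n)) :
    ConfigInv corrupt (Config.init K.n H) where
  replica P _ := by simpa [Config.init] using ReplicaInv.init P
  feasible :=
    { received := fun _ _ _ h => by cases h
      certs := fun _ _ _ h => by cases h
      sent := fun _ _ _ h => by cases h }
  finite_sent := Set.finite_empty

theorem ConfigInv.step {corrupt : Finset (Fin K.n)} {offset : Fin K.n → ℝ} {t : ℝ}
    {c c' : Config K.n H} (inv : ConfigInv corrupt c) (h : Step K corrupt offset t c c') :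
    ConfigInv corrupt c' := by
  cases h with
  | idle => exact inv
  | start P honest not_started =>
    refine ⟨fun Q hQ => ?_, ⟨fun Q hQ => ?_, fun Q hQ => ?_, inv.feasible.sent⟩, inv.finite_sent⟩
    all_goals
      rcases eq_or_ne Q P with rfl | hne
      all_goals simp only [Function.update_self, ne_eq, not_false_eq_true, *,
        Function.update_of_ne]
    · exact (inv.replica Q hQ).next _ fun h => by omega
    · exact inv.replica Q hQ
    · exact inv.feasible.received Q hQ
    · exact inv.feasible.received Q hQ
    · exact inv.feasible.certs Q hQ
    · exact inv.feasible.certs Q hQ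
  | deliver src dst m honest from_honest from_corrupt =>
    have hm : Feasible K corrupt c.signed m := by
      by_cases hs : src ∈ corrupt
      · exact from_corrupt hs
      · exact inv.feasible.sent src hs _ (from_honest hs)
    refine ⟨fun Q hQ => ?_, ⟨fun Q hQ => ?_, fun Q hQ => ?_, inv.feasible.sent⟩, inv.finite_sent⟩
    all_goals
      rcases eq_or_ne Q dst with rfl | hne
      all_goals simp only [Function.update_self, ne_eq, not_false_eq_true, *,
        Function.update_of_ne]
    · exact (inv.replica Q hQ).receive _ _
    · exact inv.replica Q hQ
    · intro x hx
      rcases hx with rfl | hx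
      · exact hm
      · exact inv.feasible.received Q hQ x hx
    · exact inv.feasible.received Q hQ
    · exact inv.feasible.certs Q hQ
    · exact inv.feasible.certs Q hQ
  | act P honest out sgn s' step =>
    have hsub : c.signed ⊆ c.signed ∪ {x | x.1 = P ∧ x.2 ∈ sgn} := Set.subset_union_left
    refine ⟨fun Q hQ => ?_, ⟨fun Q hQ => ?_, fun Q hQ => ?_, fun Q hQ x hx => ?_⟩, ?_⟩
    · rcases eq_or_ne Q P with rfl | hne
      · simp only [Function.update_self]
        convert (inv.replica Q hQ).localStep step using 1
        · ext x
          simp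
        · ext σ
          simp
      · simpa [hne] using inv.replica Q hQ
    · rcases eq_or_ne Q P with rfl | hne
      · simp only [Function.update_self, step.received_eq]
        exact fun x hx => (inv.feasible.received Q hQ x hx).mono hsub
      · simp only [ne_eq, hne, not_false_eq_true, Function.update_of_ne]
        exact fun x hx => (inv.feasible.received Q hQ x hx).mono hsub
    · rcases eq_or_ne Q P with rfl | hne
      · simp only [Function.update_self]
        intro σ hσ
        refine Feasible.mono hsub ?_
        rcases step.certs_subset σ hσ with h | ⟨src, h⟩ | h
        · exact inv.feasible.certs Q hQ σ h
        · exact inv.feasible.received Q hQ _ h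
        · exact feasible_cert_of_shares (inv.feasible.received Q hQ) h
      · simp only [ne_eq, hne, not_false_eq_true, Function.update_of_ne]
        exact fun σ hσ => (inv.feasible.certs Q hQ σ hσ).mono hsub
    · rcases hx with hx | ⟨rfl, hx⟩
      · exact (inv.feasible.sent Q hQ x hx).mono hsub
      · exact step.feasible_out hsub (fun σ hσ => .inr ⟨rfl, hσ⟩)
          (inv.feasible.received _ hQ) x hx
    · refine inv.finite_sent.union ((step.finite_out.image fun x => (P, x)).subset ?_)
      rintro ⟨Q, x⟩ ⟨rfl, hx⟩
      exact ⟨x, hx, rfl⟩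

/-! ### Executions -/

theorem Step.le {corrupt : Finset (Fin K.n)} {offset : Fin K.n → ℝ} {t : ℝ}
    {c c' : Config K.n H} (h : Step K corrupt offset t c c') (P : Fin K.n) :
    (c.loc P).Le (c'.loc P) := by
  cases h with
  | idle => exact .refl _
  | start Q =>
    rcases eq_or_ne P Q with rfl | hne
    · simpa using LState.le_next _ _
    · simpa [hne] using LState.Le.refl _
  | deliver src Q =>
    rcases eq_or_ne P Q with rfl | hne
    · simpa using LState.le_receive _ _ _
    · simpa [hne] using LState.Le.refl _
  | act Q _ out sgn s' step =>
    rcases eq_or_ne P Q with rfl | hne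
    · simpa using step.le
    · simpa [hne] using LState.Le.refl _

theorem Step.signed_subset {corrupt : Finset (Fin K.n)} {offset : Fin K.n → ℝ} {t : ℝ}
    {c c' : Config K.n H} (h : Step K corrupt offset t c c') : c.signed ⊆ c'.signed := by
  cases h with
  | act => exact Set.subset_union_left
  | _ => exact subset_rfl

theorem Step.slot_cases {corrupt : Finset (Fin K.n)} {offset : Fin K.n → ℝ} {t : ℝ}
    {c c' : Config K.n H} (h : Step K corrupt offset t c c') (P : Fin K.n) :
    ((c'.loc P).slot = (c.loc P).slot ∧ (c'.loc P).tstart = (c.loc P).tstart) ∨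
      ((c'.loc P).slot = (c.loc P).slot + 1 ∧ (c'.loc P).tstart = t + offset P ∧
        ((c.loc P).slot = 0 ∨
          (∃ B : Block H, B.slot = (c.loc P).slot ∧ (c.loc P).HasBlock B) ∨
            (c.loc P).HasTimeoutCert (c.loc P).slot)) := by
  cases h with
  | idle => exact .inl ⟨rfl, rfl⟩
  | start Q _ hs =>
    rcases eq_or_ne P Q with rfl | hne
    · exact .inr ⟨by simp [LState.next], by simp [LState.next], .inl hs⟩
    · simp [hne]
  | deliver src Q =>
    rcases eq_or_ne P Q with rfl | hne <;> simp [LState.receive, *]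
  | act Q _ out sgn s' step =>
    rcases eq_or_ne P Q with rfl | hne
    · simp only [Function.update_self]
      exact step.slot_cases.imp id fun ⟨h1, h2, h3⟩ => ⟨h1, h2, .inr h3⟩
    · simp [hne]

namespace Execution

variable (E : Execution K)

theorem configInv (k : ℕ) : ConfigInv E.corrupt (E.cfg k) := by
  induction k with
  | zero => exact E.init ▸ ConfigInv.init _
  | succ k ih => exact ih.step (E.step k)

theorem loc_le {k l : ℕ} (h : k ≤ l) (P : Fin K.n) : ((E.cfg k).loc P).Le ((E.cfg l).loc P) := by
  induction l, h using Nat.le_induction with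
  | base => exact .refl _
  | succ l _ ih => exact ih.trans ((E.step l).le P)

theorem signed_mono : Monotone fun k => (E.cfg k).signed :=
  monotone_nat_of_le_succ fun k => (E.step k).signed_subset

/-- The index of the configuration at time `t`. -/
noncomputable def index (t : ℝ) : ℕ := sInf {k | t < E.time k}

theorem index_mono : Monotone E.index := fun _ _ h =>
  csInf_le_csInf (OrderBot.bddBelow _) (E.time_unbounded _) fun _ hk => lt_of_le_of_lt h hk

theorem time_le_of_lt_index {k : ℕ} {t : ℝ} (h : k < E.index t) : E.time k ≤ t :=
  not_lt.1 (Nat.notMem_of_lt_sInf h)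

theorem stateAt_le {t u : ℝ} (h : t ≤ u) (P : Fin K.n) : (E.stateAt P t).Le (E.stateAt P u) :=
  E.loc_le (E.index_mono h) P

theorem at_inv (t : ℝ) : ConfigInv E.corrupt (E.toTrace.at t) := E.configInv _

theorem replicaInv {P : Fin K.n} (hP : P ∉ E.corrupt) (t : ℝ) :
    ReplicaInv K P (E.stateAt P t) {x | (P, x) ∈ (E.toTrace.at t).sent}
      {σ | (P, σ) ∈ (E.toTrace.at t).signed} :=
  (E.at_inv t).replica P hP

/-- Once the replica has started, `tstart` is its clock reading at some past step. Before the start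
it is a dummy value, hence the condition on the slot. -/
theorem tstart_le {P : Fin K.n} {t : ℝ} {k : ℕ} (hk : k ≤ E.index t)
    (hs : 1 ≤ ((E.cfg k).loc P).slot) : ((E.cfg k).loc P).tstart ≤ t + E.offset P := by
  induction k with
  | zero => simp [E.init, Config.init, LState.init] at hs
  | succ k ih =>
    rcases (E.step k).slot_cases P with ⟨h1, h2⟩ | ⟨-, h2, -⟩
    · rw [h2]
      exact ih (by omega) (h1 ▸ hs)
    · rw [h2]
      have := E.time_le_of_lt_index (t := t) (k := k) hk
      linarith

/-- Slots start at `0` and grow by at most one per step, so a replica beyond `v` has made the step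
from `v` to `v + 1`. Since `1 ≤ v`, that step is not the start of the replica, and it requires a
block or a timeout certificate. -/
theorem exits_of_slot_lt {P : Fin K.n} {v : ℕ} {t : ℝ} (hv : 1 ≤ v)
    (h : v < (E.stateAt P t).slot) :
    ∃ u ≤ t, E.ExitsWithBlock P v u ∨ E.ExitsWithTimeout P v u := by
  have key : ∀ k ≤ E.index t, v < ((E.cfg k).loc P).slot →
      ∃ u ≤ t, E.ExitsWithBlock P v u ∨ E.ExitsWithTimeout P v u := by
    intro k
    induction k with
    | zero => simp [E.init, Config.init, LState.init]
    | succ k ih =>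
      intro hk hs
      rcases (E.step k).slot_cases P with ⟨h1, -⟩ | ⟨h1, -, h2⟩
      · exact ih (by omega) (h1 ▸ hs)
      · rcases Nat.lt_or_ge v ((E.cfg k).loc P).slot with hlt | hge
        · exact ih (by omega) hlt
        · have hslot : ((E.cfg k).loc P).slot = v := by omega
          rw [hslot] at h1 h2
          refine ⟨E.time k, E.time_le_of_lt_index hk, ?_⟩
          rcases h2 with h2 | h2 | h2
          · omega
          · exact .inl ⟨k, rfl, hslot, h1, h2⟩
          · exact .inr ⟨k, rfl, hslot, h1, h2⟩
  exact key _ le_rfl h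

/-- Under synchrony there is a time by which all messages between honest replicas have arrived. -/
theorem exists_all_received {δ t : ℝ} (hδ : 0 < δ) (h : E.SynchronousAt δ t) :
    ∃ u, t ≤ u ∧ u < t + δ ∧ ∀ P ∉ E.corrupt, ∀ Q ∉ E.corrupt, ∀ m,
      (P, Q, m) ∈ (E.toTrace.at t).sent → (P, m) ∈ (E.stateAt Q u).received := by
  -- Each message has its own arrival time below `t + δ`. Only finitely many have been sent, so the
  -- maximum is still strictly below `t + δ`.
  have key : ∀ S : Set (Fin K.n × Fin K.n × Msg K.n H), S.Finite → S ⊆ (E.toTrace.at t).sent →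
      ∃ u, t ≤ u ∧ u < t + δ ∧ ∀ P ∉ E.corrupt, ∀ Q ∉ E.corrupt, ∀ m,
        (P, Q, m) ∈ S → (P, m) ∈ (E.stateAt Q u).received := by
    intro S hS
    induction S, hS using Set.Finite.induction_on with
    | empty => exact fun _ => ⟨t, le_rfl, by linarith, by simp⟩
    | @insert a S _ _ ih =>
      intro hsub
      obtain ⟨u, hu, hu', ih⟩ := ih ((Set.subset_insert _ _).trans hsub)
      by_cases ha : a.1 ∉ E.corrupt ∧ a.2.1 ∉ E.corrupt
      · obtain ⟨w, hw, hrec⟩ := h a.1 ha.1 a.2.1 ha.2 a.2.2 (hsub (Set.mem_insert _ _))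
        refine ⟨max u w, hu.trans (le_max_left _ _), max_lt hu' hw, fun P hP Q hQ m hm => ?_⟩
        rcases hm with rfl | hm
        · exact (E.stateAt_le (le_max_right _ _) _).received hrec
        · exact (E.stateAt_le (le_max_left _ _) _).received (ih P hP Q hQ m hm)
      · refine ⟨u, hu, hu', fun P hP Q hQ m hm => ?_⟩
        rcases hm with rfl | hm
        · exact absurd ⟨hP, hQ⟩ ha
        · exact ih P hP Q hQ m hm
  exact key _ (E.at_inv t).finite_sent subset_rfl

end Execution

/-! ### Counting votes -/

/-- Valid votes for a regular block carry certified fragments, so decoding can be attempted. The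
result may be `none`; success is decided separately, from the tag. -/
theorem exists_reconstructs {s : LState K.n H} {v : ℕ} {τ : Tag H} {h : Option H}
    {J : Finset (Fin K.n)} (hJ : K.f + K.p + 1 ≤ J.card)
    (hv : ∀ i ∈ J, ∃ frag, HasNotarVote K s i (.regular v τ h) frag) :
    ∃ result, Reconstructs K s (.regular v τ h) τ result := by
  obtain ⟨I, hIJ, hI⟩ := Finset.exists_subset_card_eq hJ
  have hcf : ∀ i ∈ I, ∃ cf, HasNotarVote K s i (.regular v τ h) (some cf) := by
    intro i hi
    obtain ⟨frag, hf⟩ := hv i (hIJ hi)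
    obtain ⟨cf, rfl, -⟩ := id hf.1
    exact ⟨cf, hf⟩
  choose! cf hcf using hcf
  exact ⟨_, I, cf, hI, hcf, rfl⟩

/-- The voters for `B` are disjoint from `I \ J`. Here `I` will be the honest replicas; recorded
corrupt votes for `B` do no harm, since they count on both sides. -/
theorem countVotes_add_le_allVotes {n : ℕ} {fv : Fin n → Option (Block H)} {B : Block H}
    {I J : Finset (Fin n)} (hJ : J ⊆ I) (hI : ∀ i ∈ I, fv i ≠ none)
    (hB : ∀ i ∈ I, fv i = some B → i ∈ J) :
    countVotes fv B + (I.card - J.card) ≤ allVotes fv := by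
  classical
  have h1 : (I \ J).card = I.card - J.card := Finset.card_sdiff_of_subset hJ
  rw [← h1, ← Set.ncard_coe_finset, countVotes, allVotes, ← Set.ncard_union_eq]
  · refine Set.ncard_le_ncard ?_ (Set.toFinite _)
    rintro i (hi | hi)
    · simp only [Set.mem_ofPred_eq] at hi ⊢
      simp [hi]
    · exact hI i (Finset.mem_sdiff.1 hi).1
  · refine Set.disjoint_left.2 fun i hi hi' => ?_
    have := Finset.mem_sdiff.1 hi'
    exact this.2 (hB i this.1 hi)

/-! ### Consequences of delivery and urgency -/

namespace Execution

variable {E : Execution K}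

/-- The honest replicas. -/
def honest (E : Execution K) : Finset (Fin K.n) := E.corruptᶜ

theorem mem_honest {i : Fin K.n} : i ∈ E.honest ↔ i ∉ E.corrupt := Finset.mem_compl

theorem card_honest (E : Execution K) : E.honest.card + E.corrupt.card = K.n := by
  simp [honest]

theorem le_card_honest (E : Execution K) : K.n ≤ E.honest.card + K.f := by
  have := E.card_honest
  have := E.card_corrupt
  omega

/-- All messages sent between honest replicas until time `t` have been received by time `u`. -/
def Delivered (E : Execution K) (t u : ℝ) : Prop :=
  t ≤ u ∧ ∀ P ∉ E.corrupt, ∀ Q ∉ E.corrupt, ∀ m,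
    (P, Q, m) ∈ (E.toTrace.at t).sent → (P, m) ∈ (E.stateAt Q u).received

theorem SynchronousAt.exists_delivered {δ t : ℝ} (hδ : 0 < δ) (h : E.SynchronousAt δ t) :
    ∃ u, u < t + δ ∧ E.Delivered t u := by
  obtain ⟨u, h1, h2, h3⟩ := E.exists_all_received hδ h
  exact ⟨u, h2, h1, h3⟩

section
variable {P Q : Fin K.n} {t u : ℝ}

theorem mem_tree_of_reconstructs (hQ : Q ∉ E.corrupt) (hs : 1 ≤ (E.stateAt Q u).slot) {v : ℕ}
    {τ : Tag H} {M : BitStr} {path : Path H} (hp : path ∈ (E.stateAt Q u).tree)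
    (hc : .notar (.regular v τ (Path.hash K path)) ∈ (E.stateAt Q u).certs)
    (hval : K.valid ((.regular v τ (Path.hash K path), M) :: path))
    (hM : encodeTag K M = τ)
    (hr : ∃ result, Reconstructs K (E.stateAt Q u) (.regular v τ (Path.hash K path)) τ result) :
    (.regular v τ (Path.hash K path), M) :: path ∈ (E.stateAt Q u).tree := by
  by_contra hnew
  obtain ⟨result, hr⟩ := hr
  have h := (hr.eq_some_iff M).2 hM
  subst h
  exact E.urgent u Q hQ _ _ _ (.addBlock v τ _ M path hs hc hp rfl hr hval hnew)

theorem slot_ne_of_block (hQ : Q ∉ E.corrupt) (hs : 1 ≤ (E.stateAt Q u).slot) {B : Block H}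
    (hB : (E.stateAt Q u).HasBlock B) : (E.stateAt Q u).slot ≠ B.slot := by
  obtain ⟨M, path, hm⟩ := hB
  exact fun h => E.urgent u Q hQ _ _ _ (.exitBlock B M path hs h.symm hm)

theorem slot_ne_of_timeoutCert (hQ : Q ∉ E.corrupt) (hs : 1 ≤ (E.stateAt Q u).slot) {v : ℕ}
    (hc : (E.stateAt Q u).HasTimeoutCert v) : (E.stateAt Q u).slot ≠ v := by
  rintro rfl
  exact E.urgent u Q hQ _ _ _ (.exitTimeout hs hc)

theorem cert_mem_of_shares (hQ : Q ∉ E.corrupt) (hs : 1 ≤ (E.stateAt Q u).slot) {σ : Signable H}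
    (hσ : Certifiable σ) (h : threshold K σ ≤ {i | HasShare K (E.stateAt Q u) i σ}.ncard) :
    σ ∈ (E.stateAt Q u).certs := by
  by_contra hnew
  exact E.urgent u Q hQ _ _ _ (.addCert σ hs hσ hnew (.inr h))

/-- A certificate is broadcast when it enters a pool, so it has arrived, and urgency puts it into
the recipient's pool. -/
theorem Delivered.certs_subset (hd : E.Delivered t u) (hP : P ∉ E.corrupt) (hQ : Q ∉ E.corrupt)
    (hs : 1 ≤ (E.stateAt Q u).slot) : (E.stateAt P t).certs ⊆ (E.stateAt Q u).certs := by
  intro σ hσ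
  by_contra hnew
  obtain ⟨h1, h2⟩ := (E.replicaInv hP t).certs σ hσ
  exact E.urgent u Q hQ _ _ _ (.addCert σ hs h1 hnew (.inl ⟨P, hd.2 P hP Q hQ _ (h2 Q)⟩))

theorem Delivered.hasNotarVote (hd : E.Delivered t u) (hP : P ∉ E.corrupt) (hQ : Q ∉ E.corrupt)
    {B : Block H} (hB : (P, .notar B) ∈ (E.toTrace.at t).signed) :
    ∃ frag, HasNotarVote K (E.stateAt Q u) P B frag := by
  obtain ⟨frag, h1, h2⟩ := (E.replicaInv hP t).notar_sent B hB
  exact ⟨frag, h1, P, (h2 Q).imp (hd.2 P hP Q hQ _) (hd.2 P hP Q hQ _)⟩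

/-- Induction along the path: the parent is transferred first, then the certificate, and the honest
votes behind the certificate supply the fragments. -/
theorem Delivered.tree_subset (hd : E.Delivered t u) (hP : P ∉ E.corrupt) (hQ : Q ∉ E.corrupt)
    (hs : 1 ≤ (E.stateAt Q u).slot) : (E.stateAt P t).tree ⊆ (E.stateAt Q u).tree := by
  classical
  intro path
  induction path with
  | nil => exact fun _ => (E.replicaInv hQ u).nil_mem
  | cons a path ih =>
    obtain ⟨B, M⟩ := a
    intro hmem
    obtain ⟨⟨⟨v, rfl⟩, -⟩, hp, hc, hval⟩ := (E.replicaInv hP t).tree B M path hmem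
    refine mem_tree_of_reconstructs hQ hs (ih hp) (hd.certs_subset hP hQ hs hc) hval rfl ?_
    have hf := (E.at_inv t).feasible.certs P hP _ hc
    refine exists_reconstructs (J := E.honest.filter fun i => (i, .notar (.regular v
      (encodeTag K M) (Path.hash K path))) ∈ (E.toTrace.at t).signed) ?_ fun i hi => ?_
    -- At least `n - f - p` signers, of which at most `f` are corrupt, leave `n - 2f - p ≥ f + p +
    -- 1` honest ones.
    · have h1 := E.card_corrupt
      have h2 := K.n_ge
      simp only [Feasible, threshold] at hf
      rw [← Set.ncard_coe_finset]
      simp only [Finset.coe_filter, mem_honest]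
      omega
    · rw [Finset.mem_filter, mem_honest] at hi
      exact hd.hasNotarVote hi.1 hQ hi.2

/-- If `Q` were behind at time `u`, then `P` would have left the slot of `Q` with a block or a
timeout certificate. `Q` has it by time `u` and would exit at once. -/
theorem Delivered.slot_le (hd : E.Delivered t u) (hP : P ∉ E.corrupt) (hQ : Q ∉ E.corrupt)
    (hs : 1 ≤ (E.stateAt Q u).slot) : (E.stateAt P t).slot ≤ (E.stateAt Q u).slot := by
  by_contra! hlt
  rcases (E.replicaInv hP t).exits _ hs hlt with ⟨B, hB, M, path, hm⟩ | hc
  · exact slot_ne_of_block hQ hs ⟨M, path, hd.tree_subset hP hQ hs hm⟩ hB.symm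
  · exact slot_ne_of_timeoutCert hQ hs (hd.certs_subset hP hQ hs hc) rfl

/-- A replica that stays in a slot for a time `Δ_timeout` casts its first vote. -/
theorem firstVoted_of_slot_eq (hQ : Q ∉ E.corrupt) (hs : 1 ≤ (E.stateAt Q t).slot)
    (h : (E.stateAt Q t).slot = (E.stateAt Q (t + K.Δ)).slot) :
    (E.stateAt Q (t + K.Δ)).firstVoted := by
  by_contra hnot
  -- The timer was started at or before `t` and not reset since, so it has run out at `t + Δ`.
  have h1 := (E.stateAt_le (le_add_of_nonneg_right K.Δ_nonneg) Q).tstart h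
  have h2 := E.tstart_le (P := Q) (t := t) le_rfl hs
  refine E.urgent (t + K.Δ) Q hQ _ _ _ (.firstVoteTimeout (h ▸ hs) hnot ?_)
  change (E.stateAt Q (t + K.Δ)).tstart + K.Δ ≤ _
  rw [← h1]
  change (E.stateAt Q t).tstart ≤ _ at h2
  linarith

end

/-- Votes of all honest replicas for the same block make up a certificate. -/
theorem Delivered.notar_mem {t u : ℝ} (hd : E.Delivered t u) {Q : Fin K.n} (hQ : Q ∉ E.corrupt)
    (hs : 1 ≤ (E.stateAt Q u).slot) {B : Block H}
    (h : ∀ P ∉ E.corrupt, B ∈ (E.stateAt P t).notarized) :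
    .notar B ∈ (E.stateAt Q u).certs := by
  refine cert_mem_of_shares hQ hs trivial ?_
  have h1 := E.le_card_honest
  have h2 : E.honest.card ≤ {i | HasShare K (E.stateAt Q u) i (.notar B)}.ncard := by
    rw [← Set.ncard_coe_finset]
    refine Set.ncard_le_ncard (fun i hi => ?_) (Set.toFinite _)
    have hi := mem_honest.1 (Finset.mem_coe.1 hi)
    exact hd.hasNotarVote hi hQ ((E.replicaInv hi t).notarized B (h i hi))
  simp only [threshold]
  omega

/-! ### Agreement of the honest votes in one slot -/

section
variable {t u : ℝ} {v : ℕ}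

/-- If all honest replicas are in slot `v` and have first-voted, then after the delivery of their
votes all of them have recorded the same first votes of honest replicas. -/
theorem exists_first_votes (hd : E.Delivered t u) (hv : 1 ≤ v)
    (ht : ∀ Q ∉ E.corrupt, (E.stateAt Q t).slot = v ∧ (E.stateAt Q t).firstVoted)
    (hu : ∀ Q ∉ E.corrupt, (E.stateAt Q u).slot = v) :
    ∃ b : Fin K.n → Block H, ∀ i ∉ E.corrupt,
      (b i).slot = v ∧ (i, .first (b i)) ∈ (E.toTrace.at t).signed ∧
      ∀ Q ∉ E.corrupt, (E.stateAt Q u).firstVote i = some (b i) ∧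
        ∃ frag, HasFirstVote K (E.stateAt Q u) i (b i) frag := by
  have key : ∀ i, i ∉ E.corrupt → ∃ B : Block H,
      B.slot = v ∧ (i, .first B) ∈ (E.toTrace.at t).signed ∧
      ∀ Q ∉ E.corrupt, (E.stateAt Q u).firstVote i = some B ∧
        ∃ frag, HasFirstVote K (E.stateAt Q u) i B frag := by
    intro i hi
    obtain ⟨B, frag, h1, h2, h3, h4⟩ := (E.replicaInv hi t).first_voted (ht i hi).2
    rw [(ht i hi).1] at h1
    refine ⟨B, h1, h2, fun Q hQ => ?_⟩
    have hrec : HasFirstVote K (E.stateAt Q u) i B frag := ⟨h3, i, hd.2 i hi Q hQ _ (h4 Q)⟩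
    refine ⟨?_, frag, hrec⟩
    have hsl := hu Q hQ
    cases hB : (E.stateAt Q u).firstVote i with
    | none =>
      exact absurd (.recordFirstVote i B frag (hsl ▸ hv) (h1.trans hsl.symm) hrec hB)
        (E.urgent u Q hQ _ _ _)
    | some B' =>
      -- A vote recorded earlier may have come through any sender, but its signature is genuine, and
      -- an honest replica signs only one first vote per slot.
      obtain ⟨h5, frag', h6⟩ := (E.replicaInv hQ u).recorded i B' hB
      have h7 : (i, .first B') ∈ (E.toTrace.at u).signed :=
        signed_of_hasShare (σ := .first B') ((E.at_inv u).feasible.received Q hQ) hi ⟨frag', h6⟩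
      rw [(E.replicaInv hi u).first_unique B' B h7 (E.signed_mono (E.index_mono hd.1) h2)
        (h5.trans (hsl.trans h1.symm))]
  classical
  -- This only supplies an inhabitant of `Block H`, the default value that `choose!` needs at
  -- corrupt indices.
  obtain ⟨a, ha⟩ : E.honest.Nonempty := by
    rw [← Finset.card_pos]
    have := E.le_card_honest
    have := K.n_ge
    omega
  obtain ⟨B₀, -⟩ := key a (mem_honest.1 ha)
  have : Nonempty (Block H) := ⟨B₀⟩
  choose! b hb using key
  exact ⟨b, hb⟩

/-- All honest replicas cast timeout votes, or all of them vote for the same block, which has a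
valid payload. -/
theorem notarized_cases (hd : E.Delivered t u) (hv : 1 ≤ v)
    (ht : ∀ Q ∉ E.corrupt, (E.stateAt Q t).slot = v ∧ (E.stateAt Q t).firstVoted)
    (hu : ∀ Q ∉ E.corrupt, (E.stateAt Q u).slot = v) :
    (∀ Q ∉ E.corrupt, .timeout v ∈ (E.stateAt Q u).notarized) ∨
      ∃ τ h, PayloadValid K v τ h ∧ ∀ Q ∉ E.corrupt,
        .regular v τ h ∈ (E.stateAt Q u).notarized ∧
          ∃ path ∈ (E.stateAt Q u).tree, Path.hash K path = h := by
  classical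
  obtain ⟨b, hb⟩ := exists_first_votes hd hv ht hu
  have hcard := E.le_card_honest
  have hn := K.n_ge
  have hvoted : ∀ Q ∉ E.corrupt, (E.stateAt Q u).firstVoted := fun Q hQ =>
    (E.stateAt_le hd.1 Q).firstVoted ((ht Q hQ).1.trans (hu Q hQ).symm) (ht Q hQ).2
  let J : Block H → Finset (Fin K.n) := fun B => E.honest.filter fun i => b i = B
  -- The case distinction counts honest first votes only, so it does not depend on the replica,
  -- although recorded corrupt votes may differ between replicas.
  by_cases hsplit : ∀ B : Block H, B.IsRegular →
      (J B).card + (K.f + K.p + 1) ≤ E.honest.card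
  · left
    intro Q hQ
    have hsl := hu Q hQ
    by_contra hnew
    have hrec : ∀ i ∈ E.honest, (E.stateAt Q u).firstVote i = some (b i) := fun i hi =>
      ((hb i (mem_honest.1 hi)).2.2 Q hQ).1
    have hle : ∀ B : Block H, countVotes (E.stateAt Q u).firstVote B +
        (E.honest.card - (J B).card) ≤ allVotes (E.stateAt Q u).firstVote := fun B =>
      countVotes_add_le_allVotes (Finset.filter_subset _ _) (fun i hi => by simp [hrec i hi])
        fun i hi hB => Finset.mem_filter.2 ⟨hi, Option.some.inj ((hrec i hi).symm.trans hB)⟩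
    -- This gives `f + p + 1 ≤ allVotes`, so the truncated subtraction in `hmax` is a true one.
    have hall : E.honest.card ≤ allVotes (E.stateAt Q u).firstVote := by
      rw [← Set.ncard_coe_finset]
      refine Set.ncard_le_ncard (fun i hi => ?_) (Set.toFinite _)
      simp [hrec i (Finset.mem_coe.1 hi)]
    have hmax : maxVotes (E.stateAt Q u).firstVote ≤
        allVotes (E.stateAt Q u).firstVote - (K.f + K.p + 1) := by
      refine csSup_le' ?_
      rintro k ⟨B, hB, rfl⟩
      have := hsplit B hB
      have := hle B
      omega
    refine E.urgent u Q hQ _ _ _ (.splitTimeout (hsl ▸ hv) (hvoted Q hQ) ?_ (hsl ▸ hnew))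
    change maxVotes (E.stateAt Q u).firstVote + _ ≤ allVotes (E.stateAt Q u).firstVote
    omega
  · push Not at hsplit
    obtain ⟨B, hB, hlt⟩ := hsplit
    -- There are at least `n - f ≥ 2f + 2p + 1` honest replicas, and fewer than `f + p + 1` of them
    -- did not vote for `B`.
    have hJ : K.f + K.p + 1 ≤ (J B).card := by omega
    have hmem : ∀ i ∈ J B, i ∉ E.corrupt ∧ b i = B := fun i hi =>
      ⟨mem_honest.1 (Finset.mem_filter.1 hi).1, (Finset.mem_filter.1 hi).2⟩
    obtain ⟨a, ha⟩ : (J B).Nonempty := Finset.card_pos.1 (by omega)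
    obtain ⟨haH, haB⟩ := hmem a ha
    obtain ⟨hslot, hsigned, -⟩ := hb a haH
    rw [haB] at hslot hsigned
    obtain ⟨w, τ, h⟩ | w := B
    swap
    · exact hB.elim
    change w = v at hslot
    subst hslot
    -- An honest first voter has the parent in its tree; one delivery brings it to everybody, as the
    -- second look requires.
    obtain ⟨path, hpath, hhash⟩ := ((E.replicaInv haH t).first_signed _ hsigned).2.2 _ _ _ rfl
    have hlook : ∀ Q ∉ E.corrupt, path ∈ (E.stateAt Q u).tree ∧
        .regular w τ h ∈ (E.stateAt Q u).secondLook := by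
      intro Q hQ
      have hsl := hu Q hQ
      have hs : 1 ≤ (E.stateAt Q u).slot := hsl ▸ hv
      have hp := hd.tree_subset haH hQ hs hpath
      refine ⟨hp, ?_⟩
      by_contra hnew
      have hmany : .regular w τ h ∈ manyVotes K (E.stateAt Q u).firstVote := by
        refine ⟨trivial, hJ.trans ?_⟩
        rw [← Set.ncard_coe_finset]
        refine Set.ncard_le_ncard (fun i hi => ?_) (Set.toFinite _)
        obtain ⟨hi, hiB⟩ := hmem i (Finset.mem_coe.1 hi)
        exact hiB ▸ ((hb i hi).2.2 Q hQ).1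
      obtain ⟨result, hr⟩ := exists_reconstructs (s := E.stateAt Q u) hJ fun i hi => by
        obtain ⟨hi, hiB⟩ := hmem i hi
        obtain ⟨frag, h1, src, h2⟩ := ((hb i hi).2.2 Q hQ).2
        exact ⟨frag, hiB ▸ h1, src, .inr (hiB ▸ h2)⟩
      by_cases hval : ∃ M, result = some M ∧ K.valid ((.regular w τ h, M) :: path)
      · obtain ⟨M, rfl, hval⟩ := hval
        rw [← hsl] at hmany hnew hr hval
        exact E.urgent u Q hQ _ _ _ (.secondLookNotarize τ h M path hs (hvoted Q hQ) hmany hnew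
          hp hhash hr hval)
      · push Not at hval
        rw [← hsl] at hmany hnew hr hval
        exact E.urgent u Q hQ _ _ _ (.secondLookTimeout τ h result path hs (hvoted Q hQ) hmany
          hnew hp hhash hr hval)
    have hinv : ∀ Q ∉ E.corrupt,
        (PayloadValid K w τ h → .regular w τ h ∈ (E.stateAt Q u).notarized) ∧
          (¬ PayloadValid K w τ h → .timeout w ∈ (E.stateAt Q u).notarized) := by
      intro Q hQ
      have := (E.replicaInv hQ u).looked τ h
      rw [hu Q hQ] at this
      exact this (hlook Q hQ).2
    by_cases hgood : PayloadValid K w τ h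
    · exact .inr ⟨τ, h, hgood, fun Q hQ => ⟨(hinv Q hQ).1 hgood, path, (hlook Q hQ).1, hhash⟩⟩
    · exact .inl fun Q hQ => (hinv Q hQ).2 hgood

/-- If all honest replicas have voted as in `notarized_cases`, then they leave the slot as soon as
these votes are delivered. -/
theorem lt_slot_of_notarized (hd : E.Delivered t u) (hv : 1 ≤ v)
    (ht : ∀ Q ∉ E.corrupt, (E.stateAt Q t).slot = v)
    (h : (∀ Q ∉ E.corrupt, .timeout v ∈ (E.stateAt Q t).notarized) ∨
      ∃ τ h, PayloadValid K v τ h ∧ ∀ Q ∉ E.corrupt,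
        .regular v τ h ∈ (E.stateAt Q t).notarized ∧
          ∃ path ∈ (E.stateAt Q t).tree, Path.hash K path = h)
    {Q : Fin K.n} (hQ : Q ∉ E.corrupt) : v < (E.stateAt Q u).slot := by
  have hle := (E.stateAt_le hd.1 Q).slot
  rw [ht Q hQ] at hle
  have hs : 1 ≤ (E.stateAt Q u).slot := hv.trans hle
  refine lt_of_le_of_ne hle (Ne.symm ?_)
  rcases h with h | ⟨τ, h, ⟨M, path, hcon, rfl, hM, hval⟩, hall⟩
  · exact slot_ne_of_timeoutCert hQ hs (hd.notar_mem hQ hs h)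
  · obtain ⟨-, q, hq, hhash⟩ := hall Q hQ
    -- Validity was witnessed on some consistent path. Having the same hash, it is the parent path
    -- in the tree of `Q`, so the valid payload can be attached there.
    obtain rfl : q = path := ((E.replicaInv hQ t).consistent hq).eq_of_hash_eq hcon hhash
    have hmem := mem_tree_of_reconstructs hQ hs ((E.stateAt_le hd.1 Q).tree hq)
      (hd.notar_mem hQ hs fun P hP => (hall P hP).1) hval hM
      (exists_reconstructs (J := E.honest) (by
        have := E.le_card_honest
        have := K.n_ge
        omega) fun i hi => by
          have hi := mem_honest.1 hi
          exact hd.hasNotarVote hi hQ ((E.replicaInv hi t).notarized _ (hall i hi).1))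
    exact slot_ne_of_block (B := .regular v τ _) hQ hs ⟨M, q, hmem⟩

end

end Execution

end Kudzu

/-- Liveness II: if the network is `δ`-synchronous over `[T, T + Δ_timeout + 3δ]`, and at time `T`
some honest replica `A` is in slot `v` and all honest replicas are in slot `v` or a previous one,
then every honest replica exits slot `v` before time `T + Δ_timeout + 3δ`. -/
theorem mainTheorem4 {H : Type*} (K : Kudzu.Protocol H) (E : Kudzu.Execution K)
    (δ T : ℝ) (hδ : 0 < δ) (v : ℕ)
    (hsync : E.SynchronousOver δ T (T + K.Δ + 3 * δ))
    (A : Fin K.n) (hA : A ∉ E.corrupt) (hAv : (E.stateAt A T).slot = v)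
    (hall : ∀ Q ∉ E.corrupt, 1 ≤ (E.stateAt Q T).slot ∧ (E.stateAt Q T).slot ≤ v) :
    ∀ Q ∉ E.corrupt, ∃ t, t < T + K.Δ + 3 * δ ∧
      (E.ExitsWithBlock Q v t ∨ E.ExitsWithTimeout Q v t) := by
  have hΔ := K.Δ_nonneg
  have hv : 1 ≤ v := hAv ▸ (hall A hA).1
  have hstarted : ∀ t, T ≤ t → ∀ Q ∉ E.corrupt, 1 ≤ (E.stateAt Q t).slot := fun t ht Q hQ =>
    (hall Q hQ).1.trans (E.stateAt_le ht Q).slot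
  have hdel : ∀ t, T ≤ t → t ≤ T + K.Δ + 2 * δ → ∃ u, u < t + δ ∧ E.Delivered t u :=
    fun t h1 h2 =>
      (hsync (T + K.Δ + 2 * δ) (by ring) t h1 h2).exists_delivered hδ
  have hfinish : ∀ u, u < T + K.Δ + 3 * δ → (∀ Q ∉ E.corrupt, v < (E.stateAt Q u).slot) →
      ∀ Q ∉ E.corrupt, ∃ t, t < T + K.Δ + 3 * δ ∧
        (E.ExitsWithBlock Q v t ∨ E.ExitsWithTimeout Q v t) := by
    intro u hu h Q hQ
    obtain ⟨t, ht, h⟩ := E.exits_of_slot_lt hv (h Q hQ)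
    exact ⟨t, ht.trans_lt hu, h⟩
  -- One honest replica beyond `v` by `T + Δ + 2δ` draws all others along within a further `δ`. This
  -- disposes of every early exit.
  have hcatch : ∀ t, T ≤ t → t ≤ T + K.Δ + 2 * δ → ∀ P ∉ E.corrupt, v < (E.stateAt P t).slot →
      ∀ Q ∉ E.corrupt, ∃ t, t < T + K.Δ + 3 * δ ∧
        (E.ExitsWithBlock Q v t ∨ E.ExitsWithTimeout Q v t) := by
    intro t h1 h2 P hP hlt
    obtain ⟨u, hu, hd⟩ := hdel t h1 h2
    exact hfinish u (by linarith) fun Q hQ =>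
      hlt.trans_le (hd.slot_le hP hQ (hstarted u (h1.trans hd.1) Q hQ))
  obtain ⟨u₀, hu₀, hd₀⟩ := hdel T le_rfl (by linarith)
  have hT₀ := hd₀.1
  have hle₀ : ∀ Q ∉ E.corrupt, v ≤ (E.stateAt Q u₀).slot := fun Q hQ =>
    hAv ▸ hd₀.slot_le hA hQ (hstarted u₀ hT₀ Q hQ)
  by_cases h₁ : ∃ P ∉ E.corrupt, v < (E.stateAt P (u₀ + K.Δ)).slot
  · obtain ⟨P, hP, hlt⟩ := h₁
    exact hcatch _ (by linarith) (by linarith) P hP hlt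
  push Not at h₁
  have hvoted : ∀ Q ∉ E.corrupt, (E.stateAt Q (u₀ + K.Δ)).slot = v ∧
      (E.stateAt Q (u₀ + K.Δ)).firstVoted := by
    intro Q hQ
    have h2 := (E.stateAt_le (le_add_of_nonneg_right hΔ : u₀ ≤ u₀ + K.Δ) Q).slot
    have h3 := h₁ Q hQ
    have h4 := hle₀ Q hQ
    exact ⟨by omega, Kudzu.Execution.firstVoted_of_slot_eq hQ (hstarted u₀ hT₀ Q hQ) (by omega)⟩
  obtain ⟨u₁, hu₁, hd₁⟩ := hdel (u₀ + K.Δ) (by linarith) (by linarith)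
  have hT₁ := hd₁.1
  by_cases h₂ : ∃ P ∉ E.corrupt, v < (E.stateAt P u₁).slot
  · obtain ⟨P, hP, hlt⟩ := h₂
    exact hcatch _ (by linarith) (by linarith) P hP hlt
  push Not at h₂
  have hslot : ∀ Q ∉ E.corrupt, (E.stateAt Q u₁).slot = v := fun Q hQ =>
    le_antisymm (h₂ Q hQ) ((hvoted Q hQ).1 ▸ (E.stateAt_le hT₁ Q).slot)
  -- Synchrony still applies at `u₁`, since `u₁ < u₀ + Δ + δ < T + Δ + 2δ`.
  obtain ⟨u₂, hu₂, hd₂⟩ := hdel u₁ (by linarith) (by linarith)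
  exact hfinish u₂ (by linarith) fun Q hQ => Kudzu.Execution.lt_slot_of_notarized hd₂ hv hslot
    (Kudzu.Execution.notarized_cases hd₁ hv hvoted hslot) hQ
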